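/- **Theorem (Cauchy–Pompeiu formula and Cauchy formula on a slice).** Let $\mathbb O$ be the algebra of octonions with its standard basis $e_0=1,e_1,\dots,e_7$, i.e. $e_ie_j=-\delta_{ij}+\sum_k\epsilon_{ijk}e_k$ for $1\le i,j\le 7$, where $\epsilon$ is totally antisymmetric, equal to $1$ on $(1,2,3),(1,4,5),(2,4,6),(3,4,7),(5,3,6),(6,1,7),(7,2,5)$ and $0$ on the triples that are not permutations of these. Identify $\mathbb O$ with $\mathbb R^8$, let $|\cdot|$ be the Euclidean norm, and let $\overline{x}=x_0-\sum_{i=1}^7x_ie_i$. Let $0\le p\le 6$ be an integer and let $\eta=\sum_{i=p+1}^{7}\eta_ie_i$ with $|\eta|=1$. Identify $(x_0,\dots,x_p,r)\in\mathbb R^{p+2}$ with $\sum_{i=0}^{p}x_ie_i+r\eta\in\mathbb O$, and put $$D_\eta f=\sum_{i=0}^{p}e_i\,\partial_{x_i}f+\eta\,\partial_rf,\qquad E(x)=\frac{1}{\sigma_{p+1}}\frac{\overline x}{|x|^{p+2}}\quad(x\ne0),\qquad \sigma_{p+1}=\frac{2\,\Gamma(1/2)^{p+2}}{\Gamma\left(\frac{p+2}{2}\right)}.$$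 Let $U\subset\mathbb O$ be a bounded domain (a bounded connected non-empty open set), let $U_\eta=U\cap(\mathbb R^{p+1}\oplus\mathbb R\eta)$, regarded as an open subset of $\mathbb R^{p+2}$, and assume that $U_\eta$ has smooth boundary: near each $y\in\partial U_\eta$ the set $U_\eta$ is $\{\varphi<0\}$ for a $C^\infty$ function $\varphi$ with $\varphi(y)=0$ and $\nabla\varphi(y)\neq0$. Let $n(y)=\sum_{i=0}^{p}n_i(y)e_i+n_{p+1}(y)\eta$ be the exterior unit normal to $\partial U_\eta$ at $y$, let $dS$ be the surface measure on $\partial U_\eta$, and let $dV$ be Lebesgue measure on $\mathbb R^{p+2}$. Let $f\in C^1(U_\eta,\mathbb O)\cap C(\overline{U_\eta},\mathbb O)$ and $x\in U_\eta$. Then: 1. The function $y\mapsto E(y-x)\,(n(y)f(y))$ is integrable on $\partial U_\eta$ with respect to $dS$. 2. (Cauchy–Pompeiu formula) If $D_\eta f$ is Lebesgue integrable on $U_\eta$ (as it is when $f$ is $C^1$ up to the boundary), then $y\mapsto E(y-x)\,(D_\eta f(y))$ is integrable on $U_\eta$ and $$f(x)=\int_{\partial U_\eta}E(y-x)\,\bigl(n(y)f(y)\bigr)\,dS(y)-\int_{U_\eta}E(y-x)\,\bigl(D_\eta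 f(y)\bigr)\,dV(y).$$ 3. (Cauchy formula) If $D_\eta f=0$ on $U_\eta$, then $$f(x)=\int_{\partial U_\eta}E(y-x)\,\bigl(n(y)f(y)\bigr)\,dS(y).$$ -/

import Mathlib

open MeasureTheory
open scoped ContDiff

noncomputable section

/-- The octonions as the real inner product space `ℝ⁸`, with coordinates `x 0, …, x 7`;
the norm is the Euclidean one. The product is `Octonion.mul`. -/
abbrev Octonion : Type := EuclideanSpace ℝ (Fin 8)

namespace Octonion

/-- The seven oriented triples `(i, j, k)` with `e_i e_j = e_k`. -/
def triples : List (Fin 8 × Fin 8 × Fin 8) :=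
  [(1, 2, 3), (1, 4, 5), (2, 4, 6), (3, 4, 7), (5, 3, 6), (6, 1, 7), (7, 2, 5)]

/-- The totally antisymmetric symbol `ε_{ijk}`: the sign of `τ` if `(i, j, k)` is the
permutation by `τ` of one of the triples, and `0` otherwise. -/
def eps (i j k : Fin 8) : ℝ :=
  if (i, j, k) ∈ triples ∨ (j, k, i) ∈ triples ∨ (k, i, j) ∈ triples then 1
  else if (j, i, k) ∈ triples ∨ (i, k, j) ∈ triples ∨ (k, j, i) ∈ triples then -1
  else 0

/-- The coefficient of `e_k` in the product `e_i e_j`: `e_0 = 1` is the unit, and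
`e_i e_j = -δ_{ij} + ∑ k, ε_{ijk} e_k` for `i, j ≠ 0`. -/
def structureConst (i j k : Fin 8) : ℝ :=
  if i = 0 then (if j = k then 1 else 0)
  else if j = 0 then (if i = k then 1 else 0)
  else if k = 0 then (if i = j then -1 else 0)
  else eps i j k

/-- The (non-associative) product of the octonions. -/
def mul (x y : Octonion) : Octonion :=
  WithLp.toLp 2 fun k => ∑ i, ∑ j, structureConst i j k * (x i * y j)

/-- Octonionic conjugation. -/
def conj (x : Octonion) : Octonion :=
  WithLp.toLp 2 fun i => if i = 0 then x i else -x i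

/-- The standard basis element `e_i`, for `0 ≤ i ≤ 7`. -/
def e (i : ℕ) : Octonion :=
  WithLp.toLp 2 fun k => if (k : ℕ) = i then 1 else 0

/-- The unit sphere `𝕊` of `ℝ^q`, `q = 7 - p`: the octonions `∑_{i=p+1}^{7} x_i e_i` of norm one. -/
def unitSphere (p : ℕ) : Set Octonion :=
  {η | (∀ k : Fin 8, (k : ℕ) ≤ p → η k = 0) ∧ ‖η‖ = 1}

/-- The identification of `(x_0, …, x_p, r) ∈ ℝ^{p+2}` with the point
`∑_{i=0}^{p} x_i e_i + r η` of the slice `ℝ^{p+1} ⊕ ℝ η`. -/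
def sliceEmb (p : ℕ) (η : Octonion) (x : EuclideanSpace ℝ (Fin (p + 2))) : Octonion :=
  (∑ i : Fin (p + 1), x i.castSucc • e i) + x (Fin.last (p + 1)) • η

/-- The slice `U_η = U ∩ (ℝ^{p+1} ⊕ ℝ η)`, as a subset of `ℝ^{p+2}`. -/
def slice (p : ℕ) (η : Octonion) (U : Set Octonion) : Set (EuclideanSpace ℝ (Fin (p + 2))) :=
  sliceEmb p η ⁻¹' U

/-- The partial derivative `∂f/∂x_i`. -/
def partialDeriv {n : ℕ} (i : Fin n) (f : EuclideanSpace ℝ (Fin n) → Octonion)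
    (y : EuclideanSpace ℝ (Fin n)) : Octonion :=
  fderiv ℝ f y (EuclideanSpace.single i 1)

/-- The slice Cauchy-Riemann operator `D_η f = ∑_{i=0}^{p} e_i ∂_{x_i} f + η ∂_r f`. -/
def sliceD (p : ℕ) (η : Octonion) (f : EuclideanSpace ℝ (Fin (p + 2)) → Octonion)
    (y : EuclideanSpace ℝ (Fin (p + 2))) : Octonion :=
  (∑ i : Fin (p + 1), mul (e i) (partialDeriv i.castSucc f y))
    + mul η (partialDeriv (Fin.last (p + 1)) f y)

/-- The area `σ_{p+1} = 2 Γ(1/2)^{p+2} / Γ((p+2)/2)` of the unit sphere in `ℝ^{p+2}`. -/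
def sphereArea (p : ℕ) : ℝ :=
  2 * Real.Gamma (1 / 2) ^ (p + 2) / Real.Gamma (((p : ℝ) + 2) / 2)

/-- The Cauchy kernel `E(x) = x̄ / (σ_{p+1} |x|^{p+2})`. -/
def cauchyKernel (p : ℕ) (x : Octonion) : Octonion :=
  (1 / (sphereArea p * ‖x‖ ^ (p + 2))) • conj x

end Octonion

/-- `φ` is a smooth local defining function of the set `V` near its boundary point `y`:
`∇φ(y) ≠ 0` and, near `y`, `V` is the set where `φ < 0`. -/
def IsDefiningFunctionAt {n : ℕ} (V : Set (EuclideanSpace ℝ (Fin n)))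
    (y : EuclideanSpace ℝ (Fin n)) (φ : EuclideanSpace ℝ (Fin n) → ℝ) : Prop :=
  ContDiff ℝ ∞ φ ∧ φ y = 0 ∧ gradient φ y ≠ 0 ∧ ∀ᶠ z in nhds y, (z ∈ V ↔ φ z < 0)

/-- The set `V` has smooth boundary. -/
def HasSmoothBoundary {n : ℕ} (V : Set (EuclideanSpace ℝ (Fin n))) : Prop :=
  ∀ y ∈ frontier V, ∃ φ, IsDefiningFunctionAt V y φ

/-- `ν` is the exterior unit normal to `∂V` at `y`: the normalized gradient of a
smooth local defining function (it does not depend on the defining function). -/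
def IsExteriorUnitNormal {n : ℕ} (V : Set (EuclideanSpace ℝ (Fin n)))
    (y ν : EuclideanSpace ℝ (Fin n)) : Prop :=
  ∃ φ, IsDefiningFunctionAt V y φ ∧ ν = ‖gradient φ y‖⁻¹ • gradient φ y

open Classical in
/-- The exterior unit normal to `∂V` at `y`, with value `0` where there is none. -/
def exteriorUnitNormal {n : ℕ} (V : Set (EuclideanSpace ℝ (Fin n)))
    (y : EuclideanSpace ℝ (Fin n)) : EuclideanSpace ℝ (Fin n) :=
  if h : ∃ ν, IsExteriorUnitNormal V y ν then h.choose else 0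

end

/-!
The slice is the image of `ℝ^{p+2}` under a linear isometry `A`, and for every octonion `a` left
multiplication by `ā` inverts left multiplication by `a` up to the factor `|a|²`
(`Octonion.mul_conj_mul`). This left alternativity is all that is used of the octonions. Writing
`κ(v) g = conj(A v) g` and `α(v) g = (A v) g`, one has `κ(v) α(v) = |v|²`, the operator is
`D_η = ∑ α(e_i) ∂_i`, and the product with the Cauchy kernel is `κ(K(y - x))`, where
`K(z) = c z / |z|^{p+2}` is the Newton kernel with `c = 1 / σ_{p+1}`.

The formula is then proved for any pair `κ`, `α` with `κ(v) α(v) = |v|²`. The linear form field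
`θ(y) v = κ(K(y - x)) (α(v) f(y))` has divergence `κ(K(y - x)) (D f(y))` away from `x`
(`formDiv_kernelForm`): the derivative of `K` is the sum of a multiple of the identity and of a
rank one map, and the two contributions cancel. Multiplying `θ` by the radial cutoff
`χ(|y - x|² / ε²)` removes the singularity and adds to the divergence a scalar multiple of `f`, by
a density that is an approximate identity at `x` (`formDiv_cutoff_kernelForm`,
`tendsto_setIntegral_cutoffDensity_smul`); the Gauss–Green formula for `χ θ` becomes the
Cauchy–Pompeiu formula as `ε → 0` (`HasSmoothBoundary.cauchyPompeiu`).

The Gauss–Green formula (`HasSmoothBoundary.setIntegral_formDiv`) is needed for forms that are `C¹`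
only inside the open set, continuous on its closure, with integrable divergence, and for the
Hausdorff measure on the boundary. Near a boundary point the set lies below a graph `γ` over the
tangent plane. In graph coordinates the formula is the divergence theorem on a half space
(`setIntegral_lowerHalfSpace`), obtained from smaller half spaces by a limit, and it gives the
boundary integral of `θ(γ) (-∇h, 1)` over the parameter domain. No area formula is used to turn
this into a surface integral: on a small ball the graph is Lipschitz with constant at most `1 + ε`
and the projection is a contraction, so the Hausdorff measure and the image of Lebesgue measure
agree up to a factor `(1 + ε)^m`, while the normal and `(-∇h, 1)` are `ε`-close to the vertical. The
defect is therefore at most a constant tending to `0` with `ε` times the integral of `|θ|` over the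
boundary. A partition of unity sums these estimates, because the bound is additive, and `ε` is
arbitrary (`HasSmoothBoundary.norm_integral_formDiv_sub_le`).
-/

noncomputable section

open Filter Set Topology Metric
open scoped NNReal ENNReal

/-! ### The divergence theorem on a half space -/

theorem integral_fderiv_eq_zero_of_hasCompactSupport {F G : Type*} [NormedAddCommGroup F]
    [NormedSpace ℝ F] [FiniteDimensional ℝ F] [MeasurableSpace F] [BorelSpace F]
    (μ : Measure F) [μ.IsAddHaarMeasure] [NormedAddCommGroup G] [NormedSpace ℝ G] {g : F → G}
    (hg : ContDiff ℝ 1 g) (hgc : HasCompactSupport g) (v : F) : ∫ x, fderiv ℝ g x v ∂μ = 0 := by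
  have key := integral_smul_fderiv_eq_neg_fderiv_smul_of_integrable (μ := μ)
    (f := fun _ : F => (1 : ℝ)) (g := g) (v := v) (by simp)
    (by
      simp only [one_smul]
      exact ((hg.continuous_fderiv one_ne_zero).clm_apply
        continuous_const).integrable_of_hasCompactSupport (hgc.fderiv_apply (𝕜 := ℝ) v))
    (by simpa using hg.continuous.integrable_of_hasCompactSupport hgc)
    (by simp) (fun x _ => hg.differentiable one_ne_zero x)
  simpa using key

section HalfSpace

variable {m : ℕ} {G H : Type*} [NormedAddCommGroup G] [NormedSpace ℝ G]
  [NormedAddCommGroup H] [NormedSpace ℝ H]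

local notation "W" => EuclideanSpace ℝ (Fin m)

/-- A function that is `C¹` on the open lower half space and vanishes off a compact set has
integrable derivatives on every smaller closed half space. -/
theorem integrableOn_fderiv_lowerHalfSpace {κ : W × ℝ → H} {K : Set (W × ℝ)} (hK : IsCompact K)
    (hκ : ContDiffOn ℝ 1 κ {z | z.2 < 0}) (h0 : ∀ z ∉ K, κ z = 0) {t : ℝ} (ht : t < 0)
    (B : W → H →L[ℝ] G) (hB : Continuous B) (u : W × ℝ) :
    IntegrableOn (fun z : W × ℝ => B z.1 (fderiv ℝ κ z u)) {z | z.2 ≤ t} := by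
  have hopen : IsOpen {z : W × ℝ | z.2 < 0} := isOpen_lt continuous_snd continuous_const
  have hcl : IsClosed {z : W × ℝ | z.2 ≤ t} := isClosed_le continuous_snd continuous_const
  have hc : ContinuousOn (fun z : W × ℝ => B z.1 (fderiv ℝ κ z u)) {z | z.2 < 0} :=
    ((hB.comp continuous_fst).continuousOn).clm_apply
      ((hκ.continuousOn_fderiv_of_isOpen hopen le_rfl).clm_apply continuousOn_const)
  have hi : IntegrableOn (fun z : W × ℝ => B z.1 (fderiv ℝ κ z u)) (K ∩ {z | z.2 ≤ t}) :=
    (hc.mono fun z hz => lt_of_le_of_lt hz.2 ht).integrableOn_compact (hK.inter_right hcl)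
  refine hi.of_forall_sdiff_eq_zero hcl.measurableSet fun z hz => ?_
  have hzK : z ∉ K := fun h => hz.2 ⟨h, hz.1⟩
  have : κ =ᶠ[𝓝 z] fun _ => 0 := by
    filter_upwards [hK.isClosed.isOpen_compl.mem_nhds hzK] with y hy using h0 y hy
  rw [this.fderiv_eq]; simp

theorem volume_restrict_snd_le (t : ℝ) :
    (volume : Measure (W × ℝ)).restrict {z | z.2 ≤ t} =
      (volume : Measure W).prod (volume.restrict (Iic t)) := by
  have : {z : W × ℝ | z.2 ≤ t} = univ ×ˢ Iic t := by ext; simp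
  rw [this, Measure.volume_eq_prod, ← Measure.prod_restrict, Measure.restrict_univ]

/-- Horizontal derivatives integrate to zero. -/
theorem setIntegral_fderiv_horizontal_eq_zero {κ : W × ℝ → H} {K : Set (W × ℝ)} (hK : IsCompact K)
    (hκ : ContDiffOn ℝ 1 κ {z | z.2 < 0}) (h0 : ∀ z ∉ K, κ z = 0) {t : ℝ} (ht : t < 0)
    (a : H →L[ℝ] G) (v : W) :
    ∫ z in {z : W × ℝ | z.2 ≤ t}, a (fderiv ℝ κ z (v, 0)) = 0 := by
  have hint := integrableOn_fderiv_lowerHalfSpace hK hκ h0 ht (fun _ => a) continuous_const (v, 0)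
  have hopen : IsOpen {z : W × ℝ | z.2 < 0} := isOpen_lt continuous_snd continuous_const
  rw [IntegrableOn, volume_restrict_snd_le] at hint
  rw [volume_restrict_snd_le, integral_prod_symm _ hint]
  refine setIntegral_eq_zero_of_forall_eq_zero fun s hs => ?_
  have hs0 : s < 0 := lt_of_le_of_lt hs ht
  -- the restriction of `κ` to a horizontal slice
  set g : W → G := fun w => a (κ (w, s)) with hg
  have hd : ∀ w, HasFDerivAt g
      (a ∘L (fderiv ℝ κ (w, s)) ∘L ContinuousLinearMap.inl ℝ W ℝ) w := fun w => by
    have h1 : DifferentiableAt ℝ κ (w, s) :=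
      (hκ.contDiffAt (hopen.mem_nhds hs0)).differentiableAt one_ne_zero
    have h2 : HasFDerivAt (fun w : W => (w, s)) (ContinuousLinearMap.inl ℝ W ℝ) w :=
      hasFDerivAt_prodMk_left w s
    exact a.hasFDerivAt.comp w (h1.hasFDerivAt.comp w h2)
  have hg1 : ContDiff ℝ 1 g := by
    rw [contDiff_iff_contDiffAt]
    intro w
    have h1 : ContDiffAt ℝ 1 κ (w, s) := hκ.contDiffAt (hopen.mem_nhds hs0)
    exact a.contDiff.contDiffAt.comp w
      (h1.comp w (contDiffAt_id.prodMk contDiffAt_const))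
  have hgc : HasCompactSupport g := by
    refine HasCompactSupport.intro (hK.image continuous_fst) fun w hw => ?_
    have : (w, s) ∉ K := fun h => hw ⟨_, h, rfl⟩
    simp [hg, h0 _ this]
  rw [← integral_fderiv_eq_zero_of_hasCompactSupport volume hg1 hgc v]
  refine integral_congr_ae (.of_forall fun w => ?_)
  simp [(hd w).fderiv]

/-- The fundamental theorem of calculus in the vertical direction. -/
theorem setIntegral_fderiv_vertical [CompleteSpace G] {κ : W × ℝ → H} {K : Set (W × ℝ)}
    (hK : IsCompact K)
    (hκ : ContDiffOn ℝ 1 κ {z | z.2 < 0}) (h0 : ∀ z ∉ K, κ z = 0) {t : ℝ} (ht : t < 0)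
    (N : W → H →L[ℝ] G) (hN : Continuous N) :
    ∫ z in {z : W × ℝ | z.2 ≤ t}, N z.1 (fderiv ℝ κ z (0, 1)) = ∫ w, N w (κ (w, t)) := by
  have hint := integrableOn_fderiv_lowerHalfSpace hK hκ h0 ht N hN (0, 1)
  have hopen : IsOpen {z : W × ℝ | z.2 < 0} := isOpen_lt continuous_snd continuous_const
  rw [IntegrableOn, volume_restrict_snd_le] at hint
  rw [volume_restrict_snd_le, integral_prod _ hint]
  refine integral_congr_ae ?_
  filter_upwards [hint.prod_right_ae] with w hw
  have hd : ∀ s ∈ Iic t, HasDerivAt (fun s => N w (κ (w, s)))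
      (N w (fderiv ℝ κ (w, s) (0, 1))) s := by
    intro s hs
    have hs0 : s < 0 := lt_of_le_of_lt hs ht
    have h1 : DifferentiableAt ℝ κ (w, s) :=
      (hκ.contDiffAt (hopen.mem_nhds hs0)).differentiableAt one_ne_zero
    have h2 : HasFDerivAt (fun s : ℝ => (w, s)) (ContinuousLinearMap.inr ℝ W ℝ) s :=
      hasFDerivAt_prodMk_right w s
    have h3 := ((N w).hasFDerivAt.comp s (h1.hasFDerivAt.comp s h2)).hasDerivAt
    simpa [Function.comp_def] using h3
  have hlim : Tendsto (fun s => N w (κ (w, s))) atBot (𝓝 0) := by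
    have hb : BddBelow (Prod.snd '' K) := (hK.image continuous_snd).bddBelow
    obtain ⟨c, hc⟩ := hb
    refine tendsto_const_nhds.congr' ?_
    filter_upwards [eventually_lt_atBot c] with s hs
    have : (w, s) ∉ K := fun h => absurd (hc ⟨_, h, rfl⟩) (not_le.2 hs)
    simp [h0 _ this]
  simpa using integral_Iic_of_hasDerivAt_of_tendsto' hd hw hlim

/-- The divergence theorem on the lower half space, in a form adapted to graph coordinates.
Only the whole divergence is assumed integrable up to the boundary. -/
theorem setIntegral_lowerHalfSpace [CompleteSpace G] {κ : W × ℝ → H} {K : Set (W × ℝ)}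
    (hK : IsCompact K)
    (hκ : ContDiffOn ℝ 1 κ {z | z.2 < 0}) (hκc : ContinuousOn κ {z | z.2 ≤ 0})
    (h0 : ∀ z ∉ K, κ z = 0)
    {ι : Type*} [Fintype ι] (a : ι → H →L[ℝ] G) (v : ι → W)
    (N : W → H →L[ℝ] G) (hN : Continuous N)
    (hd : IntegrableOn (fun z : W × ℝ => ∑ i, a i (fderiv ℝ κ z (v i, 0))
      + N z.1 (fderiv ℝ κ z (0, 1))) {z | z.2 < 0}) :
    ∫ z in {z : W × ℝ | z.2 < 0}, (∑ i, a i (fderiv ℝ κ z (v i, 0))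
      + N z.1 (fderiv ℝ κ z (0, 1))) = ∫ w, N w (κ (w, 0)) := by
  set d := fun z : W × ℝ => ∑ i, a i (fderiv ℝ κ z (v i, 0)) + N z.1 (fderiv ℝ κ z (0, 1))
  -- exhaust the open half space by closed ones, where each derivative is integrable
  set u : ℕ → ℝ := fun n => -(1 / ((n : ℝ) + 1)) with hu
  have hu0 : ∀ n, u n < 0 := fun n => by simp only [hu]; rw [neg_lt_zero]; positivity
  have hulim : Tendsto u atTop (𝓝 0) := by
    simpa [hu] using (tendsto_one_div_add_atTop_nhds_zero_nat (𝕜 := ℝ)).neg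
  have humono : Monotone u := fun i j hij => by
    simp only [hu, neg_le_neg_iff]
    exact one_div_le_one_div_of_le (by positivity) (by exact_mod_cast Nat.add_le_add_right hij 1)
  have hn : ∀ n, ∫ z in {z : W × ℝ | z.2 ≤ u n}, d z = ∫ w, N w (κ (w, u n)) := fun n => by
    rw [integral_add, integral_finsetSum, setIntegral_fderiv_vertical hK hκ h0 (hu0 n) N hN]
    · simp [setIntegral_fderiv_horizontal_eq_zero hK hκ h0 (hu0 n)]
    · exact fun i _ => integrableOn_fderiv_lowerHalfSpace hK hκ h0 (hu0 n) (fun _ => a i)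
        continuous_const _
    · exact integrable_finsetSum _ fun i _ =>
        integrableOn_fderiv_lowerHalfSpace hK hκ h0 (hu0 n) (fun _ => a i) continuous_const _
    · exact integrableOn_fderiv_lowerHalfSpace hK hκ h0 (hu0 n) N hN _
  have hU : (⋃ n, {z : W × ℝ | z.2 ≤ u n}) = {z | z.2 < 0} := by
    ext z
    simp only [mem_iUnion, mem_ofPred_eq]
    refine ⟨fun ⟨n, h⟩ => h.trans_lt (hu0 n), fun h => ?_⟩
    exact ((hulim.eventually (lt_mem_nhds h)).exists).imp fun n h => h.le
  have hL : Tendsto (fun n => ∫ z in {z : W × ℝ | z.2 ≤ u n}, d z) atTop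
      (𝓝 (∫ z in {z : W × ℝ | z.2 < 0}, d z)) := by
    rw [← hU]
    refine tendsto_setIntegral_of_monotone
      (fun n => (isClosed_le continuous_snd continuous_const).measurableSet)
      (fun i j hij z hz => le_trans hz (humono hij)) (by rwa [hU])
  have hcl : IsClosed {z : W × ℝ | z.2 ≤ 0} := isClosed_le continuous_snd continuous_const
  obtain ⟨C, hC⟩ := (hK.inter_right hcl).exists_bound_of_continuousOn
    (f := fun z : W × ℝ => N z.1 (κ z))
    (((hN.comp continuous_fst).continuousOn).clm_apply (hκc.mono inter_subset_right))
  have hslice : ∀ s ≤ 0, Continuous fun w : W => κ (w, s) := fun s hs =>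
    hκc.comp_continuous (by fun_prop) fun w => hs
  have hR : Tendsto (fun n => ∫ w, N w (κ (w, u n))) atTop (𝓝 (∫ w, N w (κ (w, 0)))) := by
    refine tendsto_integral_of_dominated_convergence
      ((Prod.fst '' K).indicator fun _ => |C|) (fun n => ?_) ?_ (fun n => ?_) ?_
    · exact (hN.clm_apply (hslice _ (hu0 n).le)).aestronglyMeasurable
    · have hK1 := hK.image (continuous_fst : Continuous (Prod.fst : W × ℝ → W))
      exact (integrableOn_const hK1.measure_lt_top.ne).integrable_indicator hK1.measurableSet
    · refine .of_forall fun w => ?_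
      by_cases hw : w ∈ Prod.fst '' K
      · rw [indicator_of_mem hw]
        by_cases hz : (w, u n) ∈ K
        · exact (hC _ ⟨hz, (hu0 n).le⟩).trans (le_abs_self C)
        · simp [h0 _ hz]
      · have : (w, u n) ∉ K := fun h => hw ⟨_, h, rfl⟩
        rw [indicator_of_notMem hw, h0 _ this]; simp
    · refine .of_forall fun w => ?_
      have h1 : Tendsto (fun n => (w, u n)) atTop (𝓝[{z : W × ℝ | z.2 ≤ 0}] (w, 0)) :=
        tendsto_nhdsWithin_iff.2 ⟨tendsto_const_nhds.prodMk_nhds hulim,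
          .of_forall fun n => (hu0 n).le⟩
      exact ((N w).continuous.tendsto _).comp ((hκc (w, 0) (le_refl (0:ℝ))).tendsto.comp h1)
  exact tendsto_nhds_unique (hL.congr hn) hR

end HalfSpace

/-! ### The exterior unit normal -/

section Normal

variable {n : ℕ} {V : Set (EuclideanSpace ℝ (Fin n))} {y : EuclideanSpace ℝ (Fin n)}
  {φ φ' : EuclideanSpace ℝ (Fin n) → ℝ}

local notation "E" => EuclideanSpace ℝ (Fin n)

theorem continuous_gradient (hφ : ContDiff ℝ ∞ φ) : Continuous (gradient φ) :=
  (InnerProductSpace.toDual ℝ E).symm.continuous.comp (hφ.continuous_fderiv (by simp))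

theorem IsDefiningFunctionAt.eventually_eq_zero (h : IsDefiningFunctionAt V y φ) :
    ∀ᶠ z in 𝓝 y, z ∈ frontier V → φ z = 0 := by
  filter_upwards [h.2.2.2.eventually_nhds] with z hz hzV
  by_contra hne
  rcases lt_or_gt_of_ne hne with hlt | hgt
  · refine hzV.2 (mem_interior_iff_mem_nhds.2 ?_)
    filter_upwards [hz, h.1.continuous.continuousAt.eventually_lt_const hlt] with x hx hx'
    exact hx.2 hx'
  · have h1 : Vᶜ ∈ 𝓝 z := by
      filter_upwards [hz, h.1.continuous.continuousAt.eventually_const_lt hgt] with x hx hx'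
      exact fun hxV => absurd (hx.1 hxV) (not_lt.2 hx'.le)
    have h2 := mem_closure_iff_frequently.1 hzV.1
    exact h2 h1

/-- A defining function at a boundary point is one at all nearby boundary points. -/
theorem IsDefiningFunctionAt.eventually (h : IsDefiningFunctionAt V y φ) :
    ∀ᶠ z in 𝓝 y, z ∈ frontier V → IsDefiningFunctionAt V z φ := by
  filter_upwards [h.eventually_eq_zero, h.2.2.2.eventually_nhds,
    (continuous_gradient h.1).continuousAt.eventually_ne h.2.2.1] with z hz h1 h2 hzV
  exact ⟨h.1, hz hzV, h2, h1⟩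

/-- A direction along which one defining function decreases enters `V`, so no other defining
function increases along it. -/
theorem IsDefiningFunctionAt.inner_gradient_nonpos (h : IsDefiningFunctionAt V y φ)
    (h' : IsDefiningFunctionAt V y φ') {v : E} (hv : inner ℝ (gradient φ y) v < 0) :
    inner ℝ (gradient φ' y) v ≤ 0 := by
  rw [inner_gradient_left] at *
  have hline : HasDerivAt (fun t : ℝ => y + t • v) v 0 := by
    simpa using ((hasDerivAt_id (0 : ℝ)).smul_const v).const_add y
  have hD : ∀ ψ : E → ℝ, ContDiff ℝ ∞ ψ →
      HasDerivAt (fun t : ℝ => ψ (y + t • v)) (fderiv ℝ ψ y v) 0 := fun ψ hψ => by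
    have h1 : HasFDerivAt ψ (fderiv ℝ ψ y) (y + (0 : ℝ) • v) := by
      simpa using (hψ.differentiable (by simp) y).hasFDerivAt
    exact h1.comp_hasDerivAt 0 hline
  have hlim : Tendsto (fun t : ℝ => y + t • v) (𝓝 0) (𝓝 y) := by
    simpa using hline.continuousAt.tendsto
  -- along `v` the first function decreases, so the points lie in `V`, so the second is negative
  have h1 : ∀ᶠ t : ℝ in 𝓝[>] 0, φ (y + t • v) < 0 := by
    have := (hD φ h.1).tendsto_slope_zero_right.eventually_lt_const hv
    filter_upwards [this, self_mem_nhdsWithin] with t ht ht0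
    simp only [zero_add, zero_smul, add_zero, h.2.1, sub_zero, smul_eq_mul] at ht
    have := (mul_neg_iff.1 ht)
    rcases this with ⟨_, h⟩ | ⟨h, _⟩
    · exact h
    · exact absurd (inv_lt_zero.1 h) (not_lt.2 (le_of_lt ht0))
  have h2 : ∀ᶠ t : ℝ in 𝓝[>] 0, φ' (y + t • v) < 0 := by
    filter_upwards [h1, (hlim.mono_left nhdsWithin_le_nhds).eventually h.2.2.2,
      (hlim.mono_left nhdsWithin_le_nhds).eventually h'.2.2.2] with t a b c
    exact c.1 (b.2 a)
  refine le_of_tendsto (hD φ' h'.1).tendsto_slope_zero_right ?_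
  filter_upwards [h2, self_mem_nhdsWithin] with t ht ht0
  simp only [zero_add, zero_smul, add_zero, h'.2.1, sub_zero, smul_eq_mul]
  exact mul_nonpos_of_nonneg_of_nonpos (inv_nonneg.2 (le_of_lt ht0)) ht.le

/-- Two unit vectors such that every direction pointing strictly against the first does not point
along the second are equal: the direction `b - a` separates distinct ones. -/
theorem eq_of_inner_neg_imp_nonpos {a b : E} (ha : ‖a‖ = 1) (hb : ‖b‖ = 1)
    (h : ∀ v, inner ℝ a v < 0 → inner ℝ b v ≤ 0) : a = b := by
  by_contra hne
  have hlt : inner ℝ a b < 1 := inner_lt_one_iff_real_of_norm_eq_one ha hb |>.2 hne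
  have h1 := h (b - a) (by rw [inner_sub_right, real_inner_self_eq_norm_sq, ha]; linarith)
  rw [inner_sub_right, real_inner_self_eq_norm_sq, hb, real_inner_comm] at h1
  linarith

theorem norm_unit_gradient {a : E} (ha : a ≠ 0) : ‖‖a‖⁻¹ • a‖ = 1 := by
  rw [norm_smul, norm_inv, norm_norm, inv_mul_cancel₀ (norm_ne_zero_iff.2 ha)]

/-- The exterior unit normal can be computed from any defining function. -/
theorem IsDefiningFunctionAt.exteriorUnitNormal_eq (h : IsDefiningFunctionAt V y φ) :
    exteriorUnitNormal V y = ‖gradient φ y‖⁻¹ • gradient φ y := by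
  have hex : ∃ ν, IsExteriorUnitNormal V y ν := ⟨_, φ, h, rfl⟩
  rw [exteriorUnitNormal, dif_pos hex]
  obtain ⟨φ', h', he⟩ := hex.choose_spec
  rw [he]
  refine eq_of_inner_neg_imp_nonpos (norm_unit_gradient h'.2.2.1) (norm_unit_gradient h.2.2.1)
    fun v hv => ?_
  rw [real_inner_smul_left] at *
  have hpos : 0 < ‖gradient φ' y‖⁻¹ := inv_pos.2 (norm_pos_iff.2 h'.2.2.1)
  exact mul_nonpos_of_nonneg_of_nonpos (by positivity)
    (h'.inner_gradient_nonpos h (by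
      rcases mul_neg_iff.1 hv with ⟨_, h⟩ | ⟨h, _⟩
      · exact h
      · exact absurd h (not_lt.2 hpos.le)))

theorem HasSmoothBoundary.continuousOn_exteriorUnitNormal (hV : HasSmoothBoundary V) :
    ContinuousOn (exteriorUnitNormal V) (frontier V) := by
  intro y hy
  obtain ⟨φ, h⟩ := hV y hy
  have hc : ContinuousAt (fun z => ‖gradient φ z‖⁻¹ • gradient φ z) y :=
    ((continuous_gradient h.1).continuousAt.norm.inv₀ (norm_ne_zero_iff.2 h.2.2.1)).smul
      (continuous_gradient h.1).continuousAt
  refine hc.continuousWithinAt.congr_of_eventuallyEq ?_ h.exteriorUnitNormal_eq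
  filter_upwards [nhdsWithin_le_nhds h.eventually, self_mem_nhdsWithin] with z hz hzV
  exact (hz hzV).exteriorUnitNormal_eq

end Normal

/-! ### Smooth boundaries as graphs -/

section Chart

variable {m : ℕ}

local notation "W" => EuclideanSpace ℝ (Fin m)
local notation "E" => EuclideanSpace ℝ (Fin (m + 1))

/-- The orthogonal coordinates `(w, s) ↦ L (w, s)` on `ℝ^{m+1}` attached to a linear isometry `L`,
with the plain product as the domain. -/
def frameMap (L : WithLp 2 (W × ℝ) ≃ₗᵢ[ℝ] E) : (W × ℝ) ≃L[ℝ] E :=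
  (WithLp.prodContinuousLinearEquiv 2 ℝ W ℝ).symm.trans L.toContinuousLinearEquiv

theorem frameMap_apply (L : WithLp 2 (W × ℝ) ≃ₗᵢ[ℝ] E) (z : W × ℝ) :
    frameMap L z = L (WithLp.toLp 2 z) := rfl

theorem norm_frameMap_sq (L : WithLp 2 (W × ℝ) ≃ₗᵢ[ℝ] E) (z : W × ℝ) :
    ‖frameMap L z‖ ^ 2 = ‖z.1‖ ^ 2 + z.2 ^ 2 := by
  rw [frameMap_apply, L.norm_map, WithLp.prod_norm_sq_eq_of_L2]; simp

theorem inner_frameMap (L : WithLp 2 (W × ℝ) ≃ₗᵢ[ℝ] E) (z z' : W × ℝ) :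
    inner ℝ (frameMap L z) (frameMap L z') = inner ℝ z.1 z'.1 + z.2 * z'.2 := by
  rw [frameMap_apply, frameMap_apply, L.inner_map_map, WithLp.prod_inner_apply]
  simp [mul_comm]

theorem measurePreserving_frameMap (L : WithLp 2 (W × ℝ) ≃ₗᵢ[ℝ] E) :
    MeasurePreserving (frameMap L) :=
  L.measurePreserving.comp (WithLp.volume_preserving_toLp W ℝ)

/-- Orthogonal coordinates whose last axis is a given unit vector. -/
theorem exists_frameMap {ν : E} (hν : ‖ν‖ = 1) :
    ∃ L : WithLp 2 (W × ℝ) ≃ₗᵢ[ℝ] E, frameMap L (0, 1) = ν := by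
  let L₀ : WithLp 2 (W × ℝ) ≃ₗᵢ[ℝ] E :=
    ((EuclideanSpace.basisFun (Fin m) ℝ).prod (OrthonormalBasis.singleton (Fin 1) ℝ)).equiv
      (EuclideanSpace.basisFun (Fin (m + 1)) ℝ) finSumFinEquiv
  have h0 : ‖frameMap L₀ (0, 1)‖ = ‖ν‖ := by
    have := norm_frameMap_sq L₀ (0, 1)
    rw [hν]
    have h1 : ‖frameMap L₀ (0, 1)‖ ^ 2 = 1 := by simpa using this
    nlinarith [norm_nonneg (frameMap L₀ (0, 1))]
  refine ⟨L₀.trans (Submodule.reflection (ℝ ∙ (frameMap L₀ (0, 1) - ν))ᗮ), ?_⟩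
  exact Submodule.reflection_sub h0

/-- `V` is, near `y₀`, the region below the graph of `h` in the orthogonal coordinates given by
`L` and centred at `y₀`; the graph passes through `y₀` and is horizontal there. The function `h` is
globally defined and `C¹`, but describes `V` only near `y₀`. -/
structure IsGraphChart (V : Set E) (y₀ : E) (L : WithLp 2 (W × ℝ) ≃ₗᵢ[ℝ] E) (h : W → ℝ) :
    Prop where
  contDiff : ContDiff ℝ 1 h
  map_zero : h 0 = 0
  fderiv_zero : fderiv ℝ h 0 = 0
  eventually_mem_iff : ∀ᶠ z : W × ℝ in 𝓝 0, (y₀ + frameMap L z ∈ V ↔ z.2 < h z.1)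

/-- A function on `W × ℝ` that vanishes at the origin and whose derivative there is a positive
multiple of the last coordinate is, near the origin, negative exactly below a graph. -/
theorem exists_graph_of_fderiv {ψ : W × ℝ → ℝ} (hψ : ContDiff ℝ ∞ ψ) (h0 : ψ 0 = 0) {c : ℝ}
    (hc : 0 < c) (hD : ∀ z, fderiv ℝ ψ 0 z = c * z.2) :
    ∃ h : W → ℝ, ContDiff ℝ 1 h ∧ h 0 = 0 ∧ fderiv ℝ h 0 = 0 ∧
      ∀ᶠ z : W × ℝ in 𝓝 0, (ψ z < 0 ↔ z.2 < h z.1) := by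
  have hψ1 : ContDiffAt ℝ 1 ψ 0 := (hψ.of_le (by simp)).contDiffAt
  have hinv : (fderiv ℝ ψ 0 ∘L .inr ℝ W ℝ).IsInvertible := by
    refine .of_inverse (g := c⁻¹ • ContinuousLinearMap.id ℝ ℝ) ?_ ?_ <;>
    · ext; simp [hD, hc.ne']
  have hinl : fderiv ℝ ψ 0 ∘L .inl ℝ W ℝ = 0 := by ext v; simp [hD]
  set g := hψ1.implicitFunction one_ne_zero hinv with hg
  have hg0 : g 0 = 0 := hψ1.implicitFunction_apply_self one_ne_zero hinv
  have hgd : HasFDerivAt g (0 : W →L[ℝ] ℝ) 0 := by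
    have := (hψ1.hasStrictFDerivAt_implicitFunction one_ne_zero hinv).hasFDerivAt
    rw [hinl] at this
    simpa using this
  have hgc : ContDiffAt ℝ 1 g 0 := hψ1.contDiffAt_implicitFunction one_ne_zero hinv
  have hgψ : ∀ᶠ w in 𝓝 (0 : W), ψ (w, g w) = 0 := by
    have := hψ1.eventually_apply_implicitFunction one_ne_zero hinv
    rwa [h0] at this
  obtain ⟨δ, hδ, hball⟩ := Metric.eventually_nhds_iff_ball.1 (hgc.eventually (by simp))
  let χ : ContDiffBump (0 : W) := ⟨δ / 4, δ / 2, by positivity, by linarith⟩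
  have hχg : (fun w => χ w * g w) =ᶠ[𝓝 0] g := by
    filter_upwards [χ.eventuallyEq_one] with w hw
    rw [hw]; simp
  refine ⟨fun w => χ w * g w, ?_, ?_, ?_, ?_⟩
  · rw [contDiff_iff_contDiffAt]
    intro w
    by_cases hw' : w ∉ closedBall (0 : W) χ.rOut
    · refine (contDiffAt_const (c := (0 : ℝ))).congr_of_eventuallyEq ?_
      filter_upwards [isClosed_closedBall.isOpen_compl.mem_nhds hw'] with x hx
      rw [χ.zero_of_le_dist (not_le.1 (fun h => hx h)).le, zero_mul]
    rw [not_not] at hw'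
    exact χ.contDiffAt.mul (hball w (closedBall_subset_ball (by simp only [χ]; linarith) hw'))
  · simp [hg0]
  · rw [hχg.fderiv_eq, hgd.fderiv]
  · -- `ψ` is increasing in the vertical direction near the origin
    have hpos : ∀ᶠ z : W × ℝ in 𝓝 0, 0 < fderiv ℝ ψ z (0, 1) := by
      refine (((hψ.continuous_fderiv (by simp)).clm_apply
        continuous_const).continuousAt).eventually_const_lt ?_
      simpa [hD] using hc
    obtain ⟨r, hr, hrpos⟩ := Metric.eventually_nhds_iff_ball.1 hpos
    have hgr : ∀ᶠ w in 𝓝 (0 : W), g w ∈ ball (0 : ℝ) r :=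
      hgc.continuousAt.eventually_mem (by rw [hg0]; exact ball_mem_nhds _ hr)
    have hfst : Tendsto (Prod.fst : W × ℝ → W) (𝓝 0) (𝓝 0) := continuous_fst.tendsto 0
    filter_upwards [hfst.eventually hχg, hfst.eventually hgr, hfst.eventually hgψ,
      ball_mem_nhds (0 : W × ℝ) hr] with z h1 h2 h3 h4
    rw [h1]
    have hz : z.1 ∈ ball (0 : W) r ∧ z.2 ∈ ball (0 : ℝ) r := by
      rw [← mem_prod, ball_prod_same]; exact h4
    have hmono : StrictMonoOn (fun s => ψ (z.1, s)) (ball (0 : ℝ) r) := by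
      refine strictMonoOn_of_deriv_pos (convex_ball _ _)
        (hψ.continuous.comp (by fun_prop)).continuousOn fun s hs => ?_
      rw [isOpen_ball.interior_eq] at hs
      have hd : HasFDerivAt ψ (fderiv ℝ ψ (z.1, s)) (z.1, s) :=
        (hψ.differentiable (by simp) _).hasFDerivAt
      have := (hd.comp s (hasFDerivAt_prodMk_right z.1 s)).hasDerivAt.deriv
      rw [Function.comp_def] at this
      rw [this]
      refine hrpos (z.1, s) ?_
      have : (z.1, s) ∈ ball (0 : W) r ×ˢ ball (0 : ℝ) r := ⟨hz.1, hs⟩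
      rwa [ball_prod_same] at this
    have := hmono.lt_iff_lt hz.2 h2
    simp only [h3] at this
    exact this

/-- A smooth boundary is locally a graph over its tangent plane. -/
theorem IsDefiningFunctionAt.exists_isGraphChart {V : Set E} {y₀ : E} {φ : E → ℝ}
    (hφ : IsDefiningFunctionAt V y₀ φ) :
    ∃ (L : WithLp 2 (W × ℝ) ≃ₗᵢ[ℝ] E) (h : W → ℝ), IsGraphChart V y₀ L h ∧
      frameMap L (0, 1) = exteriorUnitNormal V y₀ := by
  obtain ⟨L, hL⟩ := exists_frameMap (norm_unit_gradient hφ.2.2.1)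
  have hne := norm_pos_iff.2 hφ.2.2.1
  have hgrad : gradient φ y₀ = ‖gradient φ y₀‖ • frameMap L (0, 1) := by
    rw [hL, smul_smul, mul_inv_cancel₀ hne.ne', one_smul]
  have hc : Continuous fun z : W × ℝ => y₀ + frameMap L z :=
    continuous_const.add (frameMap L).continuous
  have hψ : ContDiff ℝ ∞ fun z : W × ℝ => φ (y₀ + frameMap L z) :=
    hφ.1.comp (contDiff_const.add (frameMap L).contDiff)
  obtain ⟨h, h1, h2, h3, h4⟩ := exists_graph_of_fderiv hψ (by simpa using hφ.2.1) hne fun z => by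
    have hd : HasFDerivAt φ (fderiv ℝ φ y₀) (y₀ + frameMap L 0) := by
      rw [map_zero, add_zero]; exact (hφ.1.differentiable (by simp) y₀).hasFDerivAt
    have := (hd.comp 0 ((frameMap L).hasFDerivAt.const_add y₀)).fderiv
    rw [Function.comp_def] at this
    rw [this]
    change fderiv ℝ φ y₀ (frameMap L z) = _
    rw [← inner_gradient_left, hgrad, real_inner_smul_left, inner_frameMap]
    have hN : ‖frameMap L (0, 1)‖ = 1 := by rw [hL, norm_unit_gradient hφ.2.2.1]
    simp [norm_smul, hN]
  refine ⟨L, h, ⟨h1, h2, h3, ?_⟩, by rw [hL, hφ.exteriorUnitNormal_eq]⟩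
  have ht : Tendsto (fun z : W × ℝ => y₀ + frameMap L z) (𝓝 0) (𝓝 y₀) := by
    simpa using hc.tendsto 0
  filter_upwards [ht.eventually hφ.2.2.2, h4] with z a b
  exact a.trans b

end Chart

/-! ### Comparison of measures -/

section MeasureComparison

theorem LipschitzOnWith.euclideanHausdorffMeasure_image_le {X Y : Type*} [EMetricSpace X]
    [MeasurableSpace X] [BorelSpace X] [EMetricSpace Y] [MeasurableSpace Y] [BorelSpace Y]
    {C : ℝ≥0} {f : X → Y} {s : Set X} (hf : LipschitzOnWith C f s) (d : ℕ) :
    Measure.euclideanHausdorffMeasure d (f '' s) ≤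
      (C : ℝ≥0∞) ^ d * Measure.euclideanHausdorffMeasure d s := by
  have h := hf.hausdorffMeasure_image_le (d := d) (by simp)
  simp only [Measure.euclideanHausdorffMeasure_def, Measure.smul_apply, ENNReal.smul_def,
    smul_eq_mul, ENNReal.rpow_natCast] at h ⊢
  calc _ ≤ _ := mul_le_mul_right h _
    _ = _ := by ring

theorem AntilipschitzWith.le_euclideanHausdorffMeasure_image {X Y : Type*} [EMetricSpace X]
    [MeasurableSpace X] [BorelSpace X] [EMetricSpace Y] [MeasurableSpace Y] [BorelSpace Y]
    {f : X → Y} (hf : AntilipschitzWith 1 f) (d : ℕ) (s : Set X) :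
    Measure.euclideanHausdorffMeasure d s ≤ Measure.euclideanHausdorffMeasure d (f '' s) := by
  have h := hf.le_hausdorffMeasure_image (d := d) (by simp) s
  simp only [Measure.euclideanHausdorffMeasure_def, Measure.smul_apply, ENNReal.smul_def,
    smul_eq_mul, ENNReal.rpow_natCast, ENNReal.coe_one, one_pow, one_mul] at h ⊢
  exact mul_le_mul_right h _

variable {α G : Type*} [MeasurableSpace α] [NormedAddCommGroup G] [NormedSpace ℝ G]

/-- Integrals against two measures that agree up to a factor close to `1` are close. -/
theorem norm_integral_sub_integral_le_of_le {μ ν : Measure α} [IsFiniteMeasure ν] {c : ℝ≥0}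
    (h₁ : ν ≤ μ) (h₂ : μ ≤ (c : ℝ≥0∞) • ν) {g : α → G} (hg : Integrable g ν) :
    ‖∫ x, g x ∂μ - ∫ x, g x ∂ν‖ ≤ (c - 1) * ∫ x, ‖g x‖ ∂ν := by
  have hgc : Integrable g ((c : ℝ≥0∞) • ν) := hg.smul_measure ENNReal.coe_ne_top
  have hgμ : Integrable g μ := hgc.mono_measure h₂
  have hsub : Integrable g (μ - ν) := hgμ.mono_measure Measure.sub_le
  have hμ : μ - ν + ν = μ := Measure.sub_add_cancel_of_le h₁
  have e1 : ∫ x, g x ∂μ = ∫ x, g x ∂(μ - ν) + ∫ x, g x ∂ν := by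
    rw [← integral_add_measure hsub hg, hμ]
  have e2 : ∫ x, ‖g x‖ ∂μ = ∫ x, ‖g x‖ ∂(μ - ν) + ∫ x, ‖g x‖ ∂ν := by
    rw [← integral_add_measure hsub.norm hg.norm, hμ]
  have e3 : ∫ x, ‖g x‖ ∂μ ≤ c * ∫ x, ‖g x‖ ∂ν := by
    have := integral_mono_measure h₂ (.of_forall fun x => norm_nonneg (g x)) hgc.norm
    rwa [integral_smul_measure] at this
  rw [e1, add_sub_cancel_right]
  calc _ ≤ ∫ x, ‖g x‖ ∂(μ - ν) := norm_integral_le_integral_norm _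
    _ ≤ _ := by linarith

end MeasureComparison

/-! ### Graph coordinates -/

section Graph

variable {m : ℕ}

local notation "W" => EuclideanSpace ℝ (Fin m)
local notation "E" => EuclideanSpace ℝ (Fin (m + 1))

/-- The coordinates in which the graph of `h` becomes the hyperplane `s = 0`. -/
def graphCoord (y₀ : E) (L : WithLp 2 (W × ℝ) ≃ₗᵢ[ℝ] E) (h : W → ℝ) (z : W × ℝ) : E :=
  y₀ + frameMap L (z.1, z.2 + h z.1)

variable {y₀ : EuclideanSpace ℝ (Fin (m + 1))}
  {L : WithLp 2 (EuclideanSpace ℝ (Fin m) × ℝ) ≃ₗᵢ[ℝ] EuclideanSpace ℝ (Fin (m + 1))}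
  {h : EuclideanSpace ℝ (Fin m) → ℝ}

/-- `graphCoord` as a homeomorphism. -/
def graphCoordHomeomorph (y₀ : E) (L : WithLp 2 (W × ℝ) ≃ₗᵢ[ℝ] E) (h : W → ℝ)
    (hh : Continuous h) : (W × ℝ) ≃ₜ E where
  toFun := graphCoord y₀ L h
  invFun y := (((frameMap L).symm (y - y₀)).1,
    ((frameMap L).symm (y - y₀)).2 - h ((frameMap L).symm (y - y₀)).1)
  left_inv z := by simp [graphCoord]
  right_inv y := by simp [graphCoord, -map_sub]
  continuous_toFun := by
    unfold graphCoord
    exact continuous_const.add ((frameMap L).continuous.comp (by fun_prop))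
  continuous_invFun := by
    have : Continuous fun y => (frameMap L).symm (y - y₀) :=
      (frameMap L).symm.continuous.comp (by fun_prop)
    fun_prop

theorem continuous_graphCoord (hh : Continuous h) : Continuous (graphCoord y₀ L h) :=
  (graphCoordHomeomorph y₀ L h hh).continuous

theorem measurePreserving_graphCoord (hh : Continuous h) :
    MeasurePreserving (graphCoord y₀ L h) := by
  have h1 : MeasurePreserving (fun z : W × ℝ => (z.1, z.2 + h z.1)) := by
    refine (MeasurePreserving.id (volume : Measure W)).skew_product
      (g := fun w s => s + h w) ?_ (.of_forall fun w => ?_)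
    · exact (by fun_prop : Continuous fun z : W × ℝ => z.2 + h z.1).measurable
    · exact (measurePreserving_add_right volume (h w)).map_eq
  exact (measurePreserving_add_left volume y₀).comp ((measurePreserving_frameMap L).comp h1)

theorem norm_fst_le_norm_frameMap (z : W × ℝ) : ‖z.1‖ ≤ ‖frameMap L z‖ :=
  abs_le_of_sq_le_sq' (by rw [norm_frameMap_sq]; nlinarith [sq_nonneg z.2]) (norm_nonneg _) |>.2

theorem norm_le_norm_frameMap (z : W × ℝ) : ‖z‖ ≤ ‖frameMap L z‖ := by
  refine max_le (norm_fst_le_norm_frameMap z) ?_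
  rw [Real.norm_eq_abs]
  exact abs_le_of_sq_le_sq (by rw [norm_frameMap_sq]; nlinarith [sq_nonneg ‖z.1‖])
    (norm_nonneg _)

theorem graphCoord_sub (w w' : W) : graphCoord y₀ L h (w, 0) - graphCoord y₀ L h (w', 0) =
    frameMap L (w - w', h w - h w') := by
  simp only [graphCoord, zero_add]
  rw [add_sub_add_left_eq_sub, ← map_sub, Prod.mk_sub_mk]

theorem antilipschitzWith_graphCoord :
    AntilipschitzWith 1 fun w => graphCoord y₀ L h (w, 0) := by
  refine AntilipschitzWith.of_le_mul_dist fun w w' => ?_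
  rw [dist_eq_norm, dist_eq_norm, graphCoord_sub, NNReal.coe_one, one_mul]
  exact norm_fst_le_norm_frameMap (w - w', h w - h w')

theorem lipschitzOnWith_graphCoord {ε : ℝ≥0} {s : Set W} (hs : LipschitzOnWith ε h s) :
    LipschitzOnWith (1 + ε) (fun w => graphCoord y₀ L h (w, 0)) s := by
  refine LipschitzOnWith.of_dist_le_mul fun w hw w' hw' => ?_
  have h1 := hs.dist_le_mul w hw w' hw'
  rw [dist_eq_norm, dist_eq_norm] at *
  rw [graphCoord_sub, NNReal.coe_add, NNReal.coe_one]
  refine abs_le_of_sq_le_sq' ?_ (by positivity) |>.2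
  rw [norm_frameMap_sq]
  have h2 : (h w - h w') ^ 2 ≤ (ε * ‖w - w'‖) ^ 2 := by
    rw [← sq_abs (h w - h w')]; exact pow_le_pow_left₀ (abs_nonneg _) h1 2
  have h3 : 0 ≤ (ε : ℝ) * ‖w - w'‖ ^ 2 := by positivity
  simp only
  nlinarith

/-- The vector field `(-∇h, 1)` normal to the graph of `h`, not normalized. -/
def graphNormal (L : WithLp 2 (W × ℝ) ≃ₗᵢ[ℝ] E) (h : W → ℝ) (w : W) : E :=
  frameMap L (0, 1) - ∑ i, fderiv ℝ h w (EuclideanSpace.single i 1) •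
    frameMap L (EuclideanSpace.single i 1, 0)

end Graph

/-! ### The divergence of a linear form field -/

section Divergence

variable {n : ℕ} {G : Type*} [NormedAddCommGroup G] [NormedSpace ℝ G]

/-- The trace of a bilinear map does not depend on the orthonormal basis. -/
theorem OrthonormalBasis.sum_bilinear_eq {F ι ι' : Type*} [NormedAddCommGroup F]
    [InnerProductSpace ℝ F] [Fintype ι] [Fintype ι'] (b : OrthonormalBasis ι ℝ F)
    (b' : OrthonormalBasis ι' ℝ F) (T : F →L[ℝ] F →L[ℝ] G) :
    ∑ i, T (b i) (b i) = ∑ j, T (b' j) (b' j) := by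
  classical
  have h1 : ∀ i, T (b i) (b i) = ∑ j, ∑ k, (inner ℝ (b' j) (b i) * inner ℝ (b i) (b' k)) •
      T (b' j) (b' k) := fun i => by
    conv_lhs => rw [← b'.sum_repr' (b i)]
    simp only [map_sum, map_smul, _root_.sum_apply, _root_.smul_apply,
      Finset.smul_sum, smul_smul]
    rw [Finset.sum_comm]
    refine Finset.sum_congr rfl fun j _ => Finset.sum_congr rfl fun k _ => ?_
    rw [real_inner_comm (b i) (b' k), mul_comm]
  simp_rw [h1]
  rw [Finset.sum_comm]
  refine Finset.sum_congr rfl fun j _ => ?_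
  rw [Finset.sum_comm]
  simp_rw [← Finset.sum_smul, b.sum_inner_mul_inner, orthonormal_iff_ite.1 b'.orthonormal]
  simp

/-- The divergence of a `G`-valued linear form field `θ`: the sum `∑ ∂_i (θ e_i)`. -/
def formDiv (θ : EuclideanSpace ℝ (Fin n) → EuclideanSpace ℝ (Fin n) →L[ℝ] G)
    (y : EuclideanSpace ℝ (Fin n)) : G :=
  ∑ i, fderiv ℝ θ y (EuclideanSpace.single i 1) (EuclideanSpace.single i 1)

/-- The divergence computed in the orthonormal frame given by `L`. -/
theorem formDiv_eq_frame {m : ℕ}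
    (θ : EuclideanSpace ℝ (Fin (m + 1)) → EuclideanSpace ℝ (Fin (m + 1)) →L[ℝ] G)
    (L : WithLp 2 (EuclideanSpace ℝ (Fin m) × ℝ) ≃ₗᵢ[ℝ] EuclideanSpace ℝ (Fin (m + 1)))
    (y : EuclideanSpace ℝ (Fin (m + 1))) :
    formDiv θ y = ∑ i, fderiv ℝ θ y (frameMap L (EuclideanSpace.single i 1, 0))
        (frameMap L (EuclideanSpace.single i 1, 0)) +
      fderiv ℝ θ y (frameMap L (0, 1)) (frameMap L (0, 1)) := by
  have := (EuclideanSpace.basisFun (Fin (m + 1)) ℝ).sum_bilinear_eq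
    (((EuclideanSpace.basisFun (Fin m) ℝ).prod (OrthonormalBasis.singleton (Fin 1) ℝ)).map L)
    (fderiv ℝ θ y)
  simp only [Fintype.sum_sum_type, OrthonormalBasis.map_apply, OrthonormalBasis.prod_apply] at this
  simpa [formDiv, frameMap_apply] using this

end Divergence

/-! ### The Gauss–Green formula under a graph -/

section GraphGaussGreen

variable {m : ℕ} {G : Type*} [NormedAddCommGroup G] [NormedSpace ℝ G]
  {V O : Set (EuclideanSpace ℝ (Fin (m + 1)))} {y₀ : EuclideanSpace ℝ (Fin (m + 1))}
  {L : WithLp 2 (EuclideanSpace ℝ (Fin m) × ℝ) ≃ₗᵢ[ℝ] EuclideanSpace ℝ (Fin (m + 1))}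
  {h : EuclideanSpace ℝ (Fin m) → ℝ}
  {θ : EuclideanSpace ℝ (Fin (m + 1)) → EuclideanSpace ℝ (Fin (m + 1)) →L[ℝ] G}
  {K : Set (EuclideanSpace ℝ (Fin (m + 1)))}

local notation "W" => EuclideanSpace ℝ (Fin m)
local notation "E" => EuclideanSpace ℝ (Fin (m + 1))

theorem graphCoord_mem_closure (hh : Continuous h) (hO : IsOpen O)
    (hV : ∀ z, graphCoord y₀ L h z ∈ O → (graphCoord y₀ L h z ∈ V ↔ z.2 < 0)) {z : W × ℝ}
    (hz : graphCoord y₀ L h z ∈ O) (hz0 : z.2 ≤ 0) : graphCoord y₀ L h z ∈ closure V := by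
  have hc : Tendsto (fun s : ℝ => graphCoord y₀ L h (z.1, z.2 - s)) (𝓝[>] 0)
      (𝓝 (graphCoord y₀ L h z)) := by
    have : Continuous fun s : ℝ => graphCoord y₀ L h (z.1, z.2 - s) :=
      (continuous_graphCoord hh).comp (by fun_prop)
    simpa using (this.tendsto 0).mono_left nhdsWithin_le_nhds
  refine mem_closure_of_tendsto hc ?_
  filter_upwards [hc.eventually (hO.mem_nhds hz), self_mem_nhdsWithin] with s hs hs0
  have : 0 < s := hs0
  exact (hV _ hs).2 (by simp only; linarith)

theorem graphCoord_mem_frontier_iff (hh : Continuous h) (hO : IsOpen O) (hVo : IsOpen V)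
    (hV : ∀ z, graphCoord y₀ L h z ∈ O → (graphCoord y₀ L h z ∈ V ↔ z.2 < 0)) {z : W × ℝ}
    (hz : graphCoord y₀ L h z ∈ O) : graphCoord y₀ L h z ∈ frontier V ↔ z.2 = 0 := by
  rw [hVo.frontier_eq, Set.mem_sdiff, hV z hz]
  refine ⟨fun ⟨h1, h2⟩ => le_antisymm ?_ (not_lt.1 h2), fun h1 =>
    ⟨graphCoord_mem_closure hh hO hV hz h1.le, by simp [h1]⟩⟩
  by_contra hlt
  rw [not_le] at hlt
  have hN : {z : W × ℝ | graphCoord y₀ L h z ∈ O ∧ 0 < z.2} ∈ 𝓝 z :=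
    ((hO.preimage (continuous_graphCoord hh)).inter
      (isOpen_lt continuous_const continuous_snd)).mem_nhds ⟨hz, hlt⟩
  have hN' := (graphCoordHomeomorph y₀ L h hh).isOpenMap.image_mem_nhds hN
  obtain ⟨y, ⟨z', hz', rfl⟩, hyV⟩ := mem_closure_iff_nhds.1 h1 _ hN'
  exact absurd ((hV z' hz'.1).1 hyV) (not_lt.2 hz'.2.le)

theorem contDiffOn_comp_graphCoord (hh : ContDiff ℝ 1 h) (hVo : IsOpen V)
    (hV : ∀ z, graphCoord y₀ L h z ∈ O → (graphCoord y₀ L h z ∈ V ↔ z.2 < 0))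
    (hK : IsCompact K) (hKO : K ⊆ O) (hθ : ContDiffOn ℝ 1 θ V) (h0 : ∀ y ∉ K, θ y = 0) :
    ContDiffOn ℝ 1 (fun z => θ (graphCoord y₀ L h z)) {z | z.2 < 0} := by
  intro z hz
  refine ContDiffAt.contDiffWithinAt ?_
  have hΦ : ContDiff ℝ 1 (graphCoord y₀ L h) := by
    unfold graphCoord
    exact contDiff_const.add ((frameMap L).contDiff.comp
      (contDiff_fst.prodMk (contDiff_snd.add (hh.comp contDiff_fst))))
  by_cases hzK : graphCoord y₀ L h z ∈ K
  · exact ((hθ.contDiffAt (hVo.mem_nhds ((hV z (hKO hzK)).2 hz))).comp z hΦ.contDiffAt)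
  · refine (contDiffAt_const (c := (0 : E →L[ℝ] G))).congr_of_eventuallyEq ?_
    filter_upwards [hΦ.continuous.continuousAt (hK.isClosed.isOpen_compl.mem_nhds hzK)] with x hx
    exact h0 _ hx

theorem continuousOn_comp_graphCoord (hh : Continuous h) (hO : IsOpen O)
    (hV : ∀ z, graphCoord y₀ L h z ∈ O → (graphCoord y₀ L h z ∈ V ↔ z.2 < 0))
    (hK : IsCompact K) (hKO : K ⊆ O) (hθ : ContinuousOn θ (closure V)) (h0 : ∀ y ∉ K, θ y = 0) :
    ContinuousOn (fun z => θ (graphCoord y₀ L h z)) {z | z.2 ≤ 0} := by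
  intro z hz
  have hΦ := continuous_graphCoord (y₀ := y₀) (L := L) hh
  by_cases hzK : graphCoord y₀ L h z ∈ K
  · have hzO := hKO hzK
    refine (hθ _ (graphCoord_mem_closure hh hO hV hzO hz)).tendsto.comp ?_
    refine tendsto_nhdsWithin_iff.2 ⟨hΦ.continuousWithinAt, ?_⟩
    filter_upwards [nhdsWithin_le_nhds (hΦ.continuousAt (hO.mem_nhds hzO)),
      self_mem_nhdsWithin] with x hx hx0
    exact graphCoord_mem_closure hh hO hV hx hx0
  · refine ContinuousAt.continuousWithinAt ?_
    refine (continuousAt_const (y := (0 : E →L[ℝ] G))).congr_of_eventuallyEq ?_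
    filter_upwards [hΦ.continuousAt (hK.isClosed.isOpen_compl.mem_nhds hzK)] with x hx
    exact h0 _ hx

theorem formDiv_eq_zero_of_notMem (hK : IsCompact K) (h0 : ∀ y ∉ K, θ y = 0) {y : E}
    (hy : y ∉ K) : formDiv θ y = 0 := by
  have : θ =ᶠ[𝓝 y] fun _ => 0 := by
    filter_upwards [hK.isClosed.isOpen_compl.mem_nhds hy] with x hx using h0 x hx
  simp [formDiv, this.fderiv_eq]

theorem continuous_graphNormal (hh : ContDiff ℝ 1 h) : Continuous (graphNormal L h) := by
  unfold graphNormal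
  refine continuous_const.sub (continuous_finsetSum _ fun i _ => ?_)
  exact ((hh.continuous_fderiv one_ne_zero).clm_apply continuous_const).smul continuous_const

theorem hasFDerivAt_graphCoord (hh : ContDiff ℝ 1 h) (z : W × ℝ) :
    HasFDerivAt (graphCoord y₀ L h) ((frameMap L : W × ℝ →L[ℝ] E) ∘L
      ((ContinuousLinearMap.fst ℝ W ℝ).prod
        (ContinuousLinearMap.snd ℝ W ℝ + fderiv ℝ h z.1 ∘L ContinuousLinearMap.fst ℝ W ℝ))) z := by
  have h1 : HasFDerivAt h (fderiv ℝ h z.1) z.1 := (hh.differentiable one_ne_zero z.1).hasFDerivAt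
  have h2 := (hasFDerivAt_fst (𝕜 := ℝ) (p := z)).prodMk
    ((hasFDerivAt_snd (𝕜 := ℝ) (p := z)).add (h1.comp z (hasFDerivAt_fst (𝕜 := ℝ) (p := z))))
  exact ((frameMap L).hasFDerivAt.comp z h2).const_add y₀

/-- The divergence in graph coordinates. -/
theorem formDiv_graphCoord (hh : ContDiff ℝ 1 h) {z : W × ℝ}
    (hθ : DifferentiableAt ℝ θ (graphCoord y₀ L h z)) :
    formDiv θ (graphCoord y₀ L h z) =
      ∑ i, fderiv ℝ (fun z => θ (graphCoord y₀ L h z)) z (EuclideanSpace.single i 1, 0)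
        (frameMap L (EuclideanSpace.single i 1, 0)) +
      fderiv ℝ (fun z => θ (graphCoord y₀ L h z)) z (0, 1) (graphNormal L h z.1) := by
  have hd := (hθ.hasFDerivAt.comp z (hasFDerivAt_graphCoord hh z)).fderiv
  rw [Function.comp_def] at hd
  have hv : ∀ v r, fderiv ℝ (fun z => θ (graphCoord y₀ L h z)) z (v, r) =
      fderiv ℝ θ (graphCoord y₀ L h z) (frameMap L (v, 0)) +
        (r + fderiv ℝ h z.1 v) • fderiv ℝ θ (graphCoord y₀ L h z) (frameMap L (0, 1)) := by
    intro v r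
    have : ((v, r + fderiv ℝ h z.1 v) : W × ℝ) = (v, 0) + (r + fderiv ℝ h z.1 v) • (0, 1) := by
      ext <;> simp
    rw [hd]
    change fderiv ℝ θ _ (frameMap L (v, r + fderiv ℝ h z.1 v)) = _
    rw [this, map_add, map_add, map_smul, map_smul]
  rw [formDiv_eq_frame θ L]
  simp only [hv, graphNormal]
  have h00 : ((0, 0) : W × ℝ) = 0 := rfl
  simp only [map_zero, h00, zero_add, add_zero, one_smul, _root_.add_apply, _root_.smul_apply,
    Finset.sum_add_distrib, map_sub, map_sum, map_smul]
  abel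

/-- The Gauss–Green formula in a graph chart, with the boundary term written as an integral over
the parameter domain. -/
theorem setIntegral_formDiv_graph [CompleteSpace G] (hh : ContDiff ℝ 1 h) (hO : IsOpen O)
    (hVo : IsOpen V)
    (hV : ∀ z, graphCoord y₀ L h z ∈ O → (graphCoord y₀ L h z ∈ V ↔ z.2 < 0))
    (hK : IsCompact K) (hKO : K ⊆ O) (hθ : ContDiffOn ℝ 1 θ V)
    (hθc : ContinuousOn θ (closure V)) (h0 : ∀ y ∉ K, θ y = 0)
    (hdiv : IntegrableOn (formDiv θ) V) :
    ∫ y in V, formDiv θ y = ∫ w, θ (graphCoord y₀ L h (w, 0)) (graphNormal L h w) := by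
  have hmp := measurePreserving_graphCoord (y₀ := y₀) (L := L) hh.continuous
  have hemb : MeasurableEmbedding (graphCoord y₀ L h) :=
    (graphCoordHomeomorph y₀ L h hh.continuous).measurableEmbedding
  have hK' : IsCompact (graphCoord y₀ L h ⁻¹' K) :=
    (graphCoordHomeomorph y₀ L h hh.continuous).isCompact_preimage.2 hK
  have hmeas : MeasurableSet {z : W × ℝ | z.2 < 0} :=
    (isOpen_lt continuous_snd continuous_const).measurableSet
  set d := fun z : W × ℝ => ∑ i, ContinuousLinearMap.apply ℝ G
      (frameMap L (EuclideanSpace.single i 1, 0))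
      (fderiv ℝ (fun z => θ (graphCoord y₀ L h z)) z (EuclideanSpace.single i 1, 0)) +
    ContinuousLinearMap.apply ℝ G (graphNormal L h z.1)
      (fderiv ℝ (fun z => θ (graphCoord y₀ L h z)) z (0, 1)) with hd
  -- the form vanishes off `K`, and inside `O` the chart turns `V` into the lower half space
  have hind : (graphCoord y₀ L h ⁻¹' V).indicator (fun z => formDiv θ (graphCoord y₀ L h z)) =
      {z : W × ℝ | z.2 < 0}.indicator d := by
    funext z
    by_cases hzK : graphCoord y₀ L h z ∈ K
    · by_cases hz : z.2 < 0
      · have hzV := (hV z (hKO hzK)).2 hz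
        rw [indicator_of_mem (by exact hzV), indicator_of_mem (by exact hz),
          formDiv_graphCoord hh ((hθ.contDiffAt (hVo.mem_nhds hzV)).differentiableAt one_ne_zero)]
        rfl
      · have hzV : graphCoord y₀ L h z ∉ V := fun h => hz ((hV z (hKO hzK)).1 h)
        rw [indicator_of_notMem (by exact hzV), indicator_of_notMem (by exact hz)]
    · have h1 : (fun z => θ (graphCoord y₀ L h z)) =ᶠ[𝓝 z] fun _ => 0 := by
        filter_upwards [hK'.isClosed.isOpen_compl.mem_nhds hzK] with x hx using h0 _ hx
      have h2 : d z = 0 := by simp [hd, h1.fderiv_eq]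
      simp [indicator_apply, formDiv_eq_zero_of_notMem hK h0 hzK, h2]
  have hdint : IntegrableOn d {z | z.2 < 0} := by
    rw [← integrable_indicator_iff hmeas, ← hind, integrable_indicator_iff
      (hVo.measurableSet.preimage hmp.measurable)]
    exact (hmp.integrableOn_comp_preimage hemb).2 hdiv
  rw [← hmp.setIntegral_preimage_emb hemb,
    ← integral_indicator (hVo.measurableSet.preimage hmp.measurable), hind,
    integral_indicator hmeas]
  exact setIntegral_lowerHalfSpace hK' (contDiffOn_comp_graphCoord hh hVo hV hK hKO hθ h0)
    (continuousOn_comp_graphCoord hh.continuous hO hV hK hKO hθc h0) (fun z hz => h0 _ hz)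
    (fun i => ContinuousLinearMap.apply ℝ G (frameMap L (EuclideanSpace.single i 1, 0)))
    (fun i => EuclideanSpace.single i 1)
    (fun w => ContinuousLinearMap.apply ℝ G (graphNormal L h w))
    ((ContinuousLinearMap.apply ℝ G).continuous.comp (continuous_graphNormal hh)) hdint

end GraphGaussGreen

/-! ### Almost flat balls -/

section LocalEstimate

variable {m : ℕ} {G : Type*} [NormedAddCommGroup G] [NormedSpace ℝ G]
  {V : Set (EuclideanSpace ℝ (Fin (m + 1)))} {y₀ : EuclideanSpace ℝ (Fin (m + 1))}
  {L : WithLp 2 (EuclideanSpace ℝ (Fin m) × ℝ) ≃ₗᵢ[ℝ] EuclideanSpace ℝ (Fin (m + 1))}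
  {h : EuclideanSpace ℝ (Fin m) → ℝ} {ε : ℝ≥0} {δ : ℝ}
  {θ : EuclideanSpace ℝ (Fin (m + 1)) → EuclideanSpace ℝ (Fin (m + 1)) →L[ℝ] G}
  {K : Set (EuclideanSpace ℝ (Fin (m + 1)))}

local notation "W" => EuclideanSpace ℝ (Fin m)
local notation "E" => EuclideanSpace ℝ (Fin (m + 1))

/-- In the ball of radius `δ` about `y₀` the set `V` is the region below the graph of `h`, and both
the graph and the exterior normal are `ε`-close to horizontal and vertical, respectively. -/
structure IsAlmostFlatBall (V : Set E) (y₀ : E) (L : WithLp 2 (W × ℝ) ≃ₗᵢ[ℝ] E) (h : W → ℝ)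
    (ε : ℝ≥0) (δ : ℝ) : Prop where
  contDiff : ContDiff ℝ 1 h
  mem_iff : ∀ z, graphCoord y₀ L h z ∈ ball y₀ δ → (graphCoord y₀ L h z ∈ V ↔ z.2 < 0)
  lipschitz : LipschitzOnWith ε h (ball 0 δ)
  norm_graphNormal_sub_le : ∀ w ∈ ball (0 : W) δ, ‖graphNormal L h w - frameMap L (0, 1)‖ ≤ ε
  norm_normal_sub_le : ∀ y ∈ frontier V, y ∈ ball y₀ δ →
    ‖exteriorUnitNormal V y - frameMap L (0, 1)‖ ≤ ε

theorem IsGraphChart.exists_isAlmostFlatBall (hc : IsGraphChart V y₀ L h)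
    (hV : HasSmoothBoundary V) (hy₀ : y₀ ∈ frontier V)
    (hL : frameMap L (0, 1) = exteriorUnitNormal V y₀) (hε : 0 < ε) :
    ∃ δ > 0, IsAlmostFlatBall V y₀ L h ε δ := by
  have hε' : (0 : ℝ) < ε := hε
  obtain ⟨δ₁, hδ₁, h1⟩ := Metric.eventually_nhds_iff_ball.1 hc.eventually_mem_iff
  have hstrict : HasStrictFDerivAt h (0 : W →L[ℝ] ℝ) 0 := by
    rw [← hc.fderiv_zero]; exact hc.contDiff.contDiffAt.hasStrictFDerivAt one_ne_zero
  obtain ⟨s, hs, hLip⟩ := hstrict.exists_lipschitzOnWith_of_nnnorm_lt ε (by simpa using hε)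
  obtain ⟨δ₂, hδ₂, h2⟩ := Metric.mem_nhds_iff.1 hs
  have hN0 : graphNormal L h 0 = frameMap L (0, 1) := by simp [graphNormal, hc.fderiv_zero]
  have hN : ∀ᶠ w in 𝓝 (0 : W), ‖graphNormal L h w - frameMap L (0, 1)‖ < ε := by
    have : Tendsto (fun w => ‖graphNormal L h w - frameMap L (0, 1)‖) (𝓝 0) (𝓝 0) := by
      have hcont : Continuous fun w => ‖graphNormal L h w - frameMap L (0, 1)‖ :=
        ((continuous_graphNormal hc.contDiff).sub continuous_const).norm
      simpa [hN0] using hcont.tendsto 0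
    exact this.eventually_lt_const hε'
  obtain ⟨δ₃, hδ₃, h3⟩ := Metric.eventually_nhds_iff_ball.1 hN
  have hn : ∀ᶠ y in 𝓝 y₀, y ∈ frontier V →
      ‖exteriorUnitNormal V y - frameMap L (0, 1)‖ < ε := by
    have h4 := ((hV.continuousOn_exteriorUnitNormal y₀ hy₀).sub
      (continuousWithinAt_const (b := frameMap L (0, 1)))).norm.tendsto
    simp only [Pi.sub_apply, hL, sub_self, norm_zero] at h4
    rw [hL]
    exact eventually_nhdsWithin_iff.1 (h4.eventually_lt_const hε')
  obtain ⟨δ₄, hδ₄, h4⟩ := Metric.eventually_nhds_iff_ball.1 hn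
  refine ⟨min (min δ₁ δ₂) (min δ₃ δ₄), by positivity, hc.contDiff, fun z hz => ?_, ?_, ?_, ?_⟩
  · have := h1 (z.1, z.2 + h z.1) (by
      rw [mem_ball_zero_iff]
      refine (norm_le_norm_frameMap (L := L) _).trans_lt ?_
      rw [mem_ball_iff_norm, graphCoord, add_sub_cancel_left] at hz
      exact hz.trans_le (by simp))
    rw [graphCoord, this]
    simp
  · exact hLip.mono ((ball_subset_ball (by simp)).trans h2)
  · exact fun w hw => (h3 w (ball_subset_ball (by simp) hw)).le
  · exact fun y hy hyb => (h4 y (ball_subset_ball (by simp) hyb) hy).le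

namespace IsAlmostFlatBall

theorem graphCoord_zero_mem_ball {w : W} (hw : graphCoord y₀ L h (w, 0) ∈ ball y₀ δ) :
    w ∈ ball (0 : W) δ := by
  rw [mem_ball_iff_norm, graphCoord, add_sub_cancel_left] at hw
  rw [mem_ball_zero_iff]
  exact (norm_fst_le_norm_frameMap (L := L) (w, 0 + h w)).trans_lt hw

theorem continuous_graph (hB : IsAlmostFlatBall V y₀ L h ε δ) :
    Continuous fun w : W => graphCoord y₀ L h (w, 0) :=
  (continuous_graphCoord hB.contDiff.continuous).comp (by fun_prop)

theorem measurableEmbedding (hB : IsAlmostFlatBall V y₀ L h ε δ) :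
    MeasurableEmbedding fun w : W => graphCoord y₀ L h (w, 0) :=
  hB.continuous_graph.measurableEmbedding antilipschitzWith_graphCoord.injective

/-- Inside the ball, the boundary of `V` is the graph. -/
theorem image_graph (hB : IsAlmostFlatBall V y₀ L h ε δ) (hVo : IsOpen V) (A : Set E) :
    (fun w : W => graphCoord y₀ L h (w, 0)) '' ((fun w : W => graphCoord y₀ L h (w, 0)) ⁻¹'
      (A ∩ ball y₀ δ)) = A ∩ (frontier V ∩ ball y₀ δ) := by
  have hiff := fun z hz => graphCoord_mem_frontier_iff hB.contDiff.continuous isOpen_ball hVo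
    hB.mem_iff (z := z) hz
  ext y
  constructor
  · rintro ⟨w, hw, rfl⟩
    exact ⟨hw.1, (hiff _ hw.2).2 rfl, hw.2⟩
  · rintro ⟨hyA, hyF, hyB⟩
    obtain ⟨z, rfl⟩ := (graphCoordHomeomorph y₀ L h hB.contDiff.continuous).surjective y
    have hz : z.2 = 0 := (hiff z hyB).1 hyF
    have hz' : z = (z.1, 0) := by rw [← hz]
    refine ⟨z.1, ?_, ?_⟩
    · rw [mem_preimage, ← hz']; exact ⟨hyA, hyB⟩
    · simp only; rw [← hz']; rfl

/-- The projection of the graph to the tangent plane is a contraction, so the image of Lebesgue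
measure is at most the surface measure. -/
theorem map_graph_restrict_le (hB : IsAlmostFlatBall V y₀ L h ε δ) (hVo : IsOpen V) :
    ((volume : Measure W).map fun w => graphCoord y₀ L h (w, 0)).restrict (ball y₀ δ) ≤
      (Measure.euclideanHausdorffMeasure m).restrict (frontier V ∩ ball y₀ δ) := by
  refine Measure.le_iff.2 fun A hA => ?_
  rw [Measure.restrict_apply hA, Measure.restrict_apply hA, ← hB.image_graph hVo,
    hB.measurableEmbedding.map_apply, ← EuclideanSpace.euclideanHausdorffMeasure_eq_volume]
  exact antilipschitzWith_graphCoord.le_euclideanHausdorffMeasure_image m _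

/-- The parametrization of the graph is `(1 + ε)`-Lipschitz, so the surface measure is at most
`(1 + ε)^m` times the image of Lebesgue measure. -/
theorem restrict_le_map_graph (hB : IsAlmostFlatBall V y₀ L h ε δ) (hVo : IsOpen V) :
    (Measure.euclideanHausdorffMeasure m).restrict (frontier V ∩ ball y₀ δ) ≤
      (((1 + ε) ^ m : ℝ≥0) : ℝ≥0∞) •
        ((volume : Measure W).map fun w => graphCoord y₀ L h (w, 0)).restrict (ball y₀ δ) := by
  refine Measure.le_iff.2 fun A hA => ?_
  rw [Measure.smul_apply, Measure.restrict_apply hA, Measure.restrict_apply hA,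
    ← hB.image_graph hVo, hB.measurableEmbedding.map_apply,
    ← EuclideanSpace.euclideanHausdorffMeasure_eq_volume, ENNReal.coe_pow]
  refine (lipschitzOnWith_graphCoord (hB.lipschitz.mono ?_)).euclideanHausdorffMeasure_image_le m
  exact fun w hw => graphCoord_zero_mem_ball hw.2

theorem isFiniteMeasure_map (hB : IsAlmostFlatBall V y₀ L h ε δ) : IsFiniteMeasure
    (((volume : Measure W).map fun w => graphCoord y₀ L h (w, 0)).restrict (ball y₀ δ)) := by
  refine ⟨?_⟩
  rw [Measure.restrict_apply_univ, hB.measurableEmbedding.map_apply]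
  exact (measure_mono fun w hw => graphCoord_zero_mem_ball hw).trans_lt
    (measure_ball_lt_top (x := (0 : W)) (r := δ))

theorem measure_frontier_inter_ball_lt_top (hB : IsAlmostFlatBall V y₀ L h ε δ)
    (hVo : IsOpen V) : Measure.euclideanHausdorffMeasure m (frontier V ∩ ball y₀ δ) < ⊤ := by
  have := hB.isFiniteMeasure_map
  have h1 := hB.restrict_le_map_graph hVo univ
  rw [Measure.restrict_apply_univ, Measure.smul_apply] at h1
  exact h1.trans_lt (ENNReal.mul_lt_top ENNReal.coe_lt_top (measure_lt_top _ _))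

end IsAlmostFlatBall

end LocalEstimate

/-! ### The Gauss–Green formula near a boundary point, up to a small error -/

section GaussGreen

variable {m : ℕ} {G : Type*} [NormedAddCommGroup G] [NormedSpace ℝ G]
  {V : Set (EuclideanSpace ℝ (Fin (m + 1)))}
  {θ : EuclideanSpace ℝ (Fin (m + 1)) → EuclideanSpace ℝ (Fin (m + 1)) →L[ℝ] G}

local notation "W" => EuclideanSpace ℝ (Fin m)
local notation "E" => EuclideanSpace ℝ (Fin (m + 1))

theorem HasSmoothBoundary.exists_isAlmostFlatBall (hV : HasSmoothBoundary V) {y₀ : E}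
    (hy₀ : y₀ ∈ frontier V) {ε : ℝ≥0} (hε : 0 < ε) :
    ∃ (L : WithLp 2 (W × ℝ) ≃ₗᵢ[ℝ] E) (h : W → ℝ), ∃ δ > 0, IsAlmostFlatBall V y₀ L h ε δ := by
  obtain ⟨φ, hφ⟩ := hV y₀ hy₀
  obtain ⟨L, h, hc, hL⟩ := hφ.exists_isGraphChart
  exact ⟨L, h, hc.exists_isAlmostFlatBall hV hy₀ hL hε⟩

theorem isCompact_frontier_of_isBounded (hVb : Bornology.IsBounded V) : IsCompact (frontier V) :=
  hVb.isCompact_closure.of_isClosed_subset isClosed_frontier frontier_subset_closure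

/-- A compact smooth boundary has finite surface measure. -/
theorem HasSmoothBoundary.measure_frontier_lt_top (hV : HasSmoothBoundary V) (hVo : IsOpen V)
    (hVb : Bornology.IsBounded V) : Measure.euclideanHausdorffMeasure m (frontier V) < ⊤ := by
  refine (isCompact_frontier_of_isBounded hVb).measure_lt_top_of_nhdsWithin fun y₀ hy₀ => ?_
  obtain ⟨L, h, δ, hδ, hB⟩ := hV.exists_isAlmostFlatBall hy₀ one_pos
  exact ⟨_, inter_mem self_mem_nhdsWithin (mem_nhdsWithin_of_mem_nhds (ball_mem_nhds y₀ hδ)),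
    hB.measure_frontier_inter_ball_lt_top hVo⟩

theorem HasSmoothBoundary.integrableOn_frontier {F : Type*} [NormedAddCommGroup F]
    (hV : HasSmoothBoundary V) (hVo : IsOpen V)
    (hVb : Bornology.IsBounded V) {g : E → F} (hg : ContinuousOn g (frontier V)) :
    IntegrableOn g (frontier V) (Measure.euclideanHausdorffMeasure m) := by
  have hc := isCompact_frontier_of_isBounded hVb
  obtain ⟨C, hC⟩ := hc.exists_bound_of_continuousOn hg
  exact IntegrableOn.of_bound (hV.measure_frontier_lt_top hVo hVb)
    (hg.aestronglyMeasurable_of_isCompact hc hc.measurableSet) C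
    ((ae_restrict_iff' hc.measurableSet).2 (.of_forall hC))

/-- The Gauss–Green formula holds up to a relative error tending to `0` with `ε` for forms
supported in an almost flat ball. The parametrization by the tangent plane changes neither the
normal nor the surface measure by more than this error. -/
theorem IsAlmostFlatBall.norm_integral_formDiv_sub_le [CompleteSpace G] {y₀ : E}
    {L : WithLp 2 (W × ℝ) ≃ₗᵢ[ℝ] E} {h : W → ℝ} {ε : ℝ≥0} {δ : ℝ} {K : Set E}
    (hB : IsAlmostFlatBall V y₀ L h ε δ) (hV : HasSmoothBoundary V) (hVo : IsOpen V)
    (hVb : Bornology.IsBounded V) (hK : IsCompact K) (hKB : K ⊆ ball y₀ δ)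
    (hθ : ContDiffOn ℝ 1 θ V) (hθc : ContinuousOn θ (closure V)) (h0 : ∀ y ∉ K, θ y = 0)
    (hdiv : IntegrableOn (formDiv θ) V) :
    ‖(∫ y in V, formDiv θ y) -
        ∫ y in frontier V, θ y (exteriorUnitNormal V y) ∂Measure.euclideanHausdorffMeasure m‖ ≤
      (2 * ε + ((1 + ε) ^ m - 1)) *
        ∫ y in frontier V, ‖θ y‖ ∂Measure.euclideanHausdorffMeasure m := by
  set γ : W → E := fun w => graphCoord y₀ L h (w, 0) with hγ
  set ν := ((volume : Measure W).map γ).restrict (ball y₀ δ) with hν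
  set μ := (Measure.euclideanHausdorffMeasure m : Measure E).restrict (frontier V ∩ ball y₀ δ)
    with hμ
  set e : E := frameMap L (0, 1) with he
  have hfin : IsFiniteMeasure ν := hB.isFiniteMeasure_map
  have hle : ν ≤ μ := hB.map_graph_restrict_le hVo
  have hge : μ ≤ (((1 + ε) ^ m : ℝ≥0) : ℝ≥0∞) • ν := hB.restrict_le_map_graph hVo
  have he1 : ‖e‖ ≤ 1 := by
    have := norm_frameMap_sq L (0, 1)
    refine abs_le_of_sq_le_sq' ?_ zero_le_one |>.2
    rw [this]; simp
  have h0B : ∀ y ∉ ball y₀ δ, θ y = 0 := fun y hy => h0 y fun h => hy (hKB h)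
  have hθf : ContinuousOn θ (frontier V) := hθc.mono frontier_subset_closure
  have hnf := hV.continuousOn_exteriorUnitNormal
  -- integrals over the boundary are integrals against `μ`
  have hsub : ∀ y ∈ frontier V \ (frontier V ∩ ball y₀ δ), θ y = 0 := fun y hy =>
    h0B y fun hyB => hy.2 ⟨hy.1, hyB⟩
  have hμF : ∫ y in frontier V, θ y (exteriorUnitNormal V y) ∂Measure.euclideanHausdorffMeasure m =
      ∫ y, θ y (exteriorUnitNormal V y) ∂μ :=
    setIntegral_eq_of_subset_of_forall_sdiff_eq_zero isClosed_frontier.measurableSet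
      inter_subset_left fun y hy => by rw [hsub y hy]; rfl
  have hμn : ∫ y in frontier V, ‖θ y‖ ∂Measure.euclideanHausdorffMeasure m = ∫ y, ‖θ y‖ ∂μ :=
    setIntegral_eq_of_subset_of_forall_sdiff_eq_zero isClosed_frontier.measurableSet
      inter_subset_left fun y hy => by rw [hsub y hy, norm_zero]
  have hintμ : ∀ g : E → G,
      ContinuousOn g (frontier V) → Integrable g μ := fun g hg =>
    (hV.integrableOn_frontier hVo hVb hg).mono_set inter_subset_left
  have hnormμ : Integrable (fun y => ‖θ y‖) μ :=
    (hV.integrableOn_frontier hVo hVb hθf.norm).mono_set inter_subset_left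
  have hnormν : Integrable (fun y => ‖θ y‖) ν := hnormμ.mono_measure hle
  have hnn : ∫ y, ‖θ y‖ ∂ν ≤ ∫ y, ‖θ y‖ ∂μ :=
    integral_mono_measure hle (.of_forall fun _ => norm_nonneg _) hnormμ
  -- integrals over the parameter domain are integrals against `ν`
  have hνW : ∫ w, θ (γ w) e = ∫ y, θ y e ∂ν := by
    rw [hν, setIntegral_eq_integral_of_forall_compl_eq_zero fun y hy => by rw [h0B y hy]; rfl,
      hB.measurableEmbedding.integral_map]
  have hνn : ∫ w, ‖θ (γ w)‖ = ∫ y, ‖θ y‖ ∂ν := by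
    rw [hν, setIntegral_eq_integral_of_forall_compl_eq_zero fun y hy => by
      rw [h0B y hy, norm_zero], hB.measurableEmbedding.integral_map]
  have hγc : Continuous fun w => θ (γ w) :=
    (continuousOn_comp_graphCoord hB.contDiff.continuous isOpen_ball hB.mem_iff hK hKB hθc
      h0).comp_continuous (by fun_prop : Continuous fun w : W => ((w, 0) : W × ℝ)) fun w =>
        le_refl (0 : ℝ)
  have hcs : HasCompactSupport fun w => θ (γ w) :=
    HasCompactSupport.intro (isCompact_closedBall (0 : W) δ) fun w hw => h0B _ fun hwB =>
      hw (ball_subset_closedBall (IsAlmostFlatBall.graphCoord_zero_mem_ball hwB))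
  have hintW : ∀ g : W → E, Continuous g → Integrable fun w => θ (γ w) (g w) := fun g hg =>
    (hγc.clm_apply hg).integrable_of_hasCompactSupport
      (hcs.mono fun w hw => by
        contrapose! hw
        simp only [Function.mem_support, not_not] at hw ⊢
        rw [hw]; rfl)
  have hnormW : Integrable fun w => ‖θ (γ w)‖ :=
    hγc.norm.integrable_of_hasCompactSupport hcs.norm
  have e1 : ‖(∫ y in V, formDiv θ y) - ∫ y, θ y e ∂ν‖ ≤ ε * ∫ y, ‖θ y‖ ∂ν := by
    rw [setIntegral_formDiv_graph hB.contDiff isOpen_ball hVo hB.mem_iff hK hKB hθ hθc h0 hdiv,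
      ← hνW,
      ← integral_sub (hintW _ (continuous_graphNormal hB.contDiff)) (hintW _ continuous_const),
      ← hνn, ← integral_const_mul]
    refine norm_integral_le_of_norm_le (hnormW.const_mul _) (.of_forall fun w => ?_)
    rw [← map_sub]
    by_cases hw : γ w ∈ ball y₀ δ
    · rw [mul_comm]
      exact ((θ (γ w)).le_opNorm _).trans (mul_le_mul_of_nonneg_left
        (hB.norm_graphNormal_sub_le w (IsAlmostFlatBall.graphCoord_zero_mem_ball hw))
        (norm_nonneg _))
    · simp [h0B _ hw]
  have e2 : ‖∫ y, θ y e ∂μ - ∫ y, θ y e ∂ν‖ ≤ ((1 + ε) ^ m - 1) * ∫ y, ‖θ y‖ ∂ν := by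
    have hi : Integrable (fun y => θ y e) ν :=
      (hintμ _ (hθf.clm_apply continuousOn_const)).mono_measure hle
    refine (norm_integral_sub_integral_le_of_le hle hge hi).trans ?_
    push_cast
    refine mul_le_mul_of_nonneg_left (integral_mono hi.norm hnormν fun y => ?_) ?_
    · exact ((θ y).le_opNorm e).trans (mul_le_of_le_one_right (norm_nonneg _) he1)
    · exact sub_nonneg.2 (one_le_pow₀ (by simp))
  have e3 : ‖∫ y, θ y e ∂μ - ∫ y, θ y (exteriorUnitNormal V y) ∂μ‖ ≤ ε * ∫ y, ‖θ y‖ ∂μ := by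
    rw [← integral_sub (hintμ _ (hθf.clm_apply continuousOn_const)) (hintμ _ (hθf.clm_apply hnf)),
      ← integral_const_mul]
    refine norm_integral_le_of_norm_le (hnormμ.const_mul _) ?_
    refine (ae_restrict_iff' (isClosed_frontier.measurableSet.inter measurableSet_ball)).2
      (.of_forall fun y hy => ?_)
    rw [← map_sub, mul_comm]
    refine ((θ y).le_opNorm _).trans (mul_le_mul_of_nonneg_left ?_ (norm_nonneg _))
    rw [norm_sub_rev]
    exact hB.norm_normal_sub_le y hy.1 hy.2
  rw [hμn, hμF]
  have hm : (0 : ℝ) ≤ (1 + ε) ^ m - 1 := sub_nonneg.2 (one_le_pow₀ (by simp))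
  calc _ = ‖((∫ y in V, formDiv θ y) - ∫ y, θ y e ∂ν) - (∫ y, θ y e ∂μ - ∫ y, θ y e ∂ν) +
        (∫ y, θ y e ∂μ - ∫ y, θ y (exteriorUnitNormal V y) ∂μ)‖ := by congr 1; abel
    _ ≤ ε * ∫ y, ‖θ y‖ ∂ν + ((1 + ε) ^ m - 1) * ∫ y, ‖θ y‖ ∂ν + ε * ∫ y, ‖θ y‖ ∂μ :=
      (norm_add_le _ _).trans (add_le_add ((norm_sub_le _ _).trans (add_le_add e1 e2)) e3)
    _ ≤ ε * ∫ y, ‖θ y‖ ∂μ + ((1 + ε) ^ m - 1) * ∫ y, ‖θ y‖ ∂μ + ε * ∫ y, ‖θ y‖ ∂μ := by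
      gcongr
    _ = _ := by ring

end GaussGreen

/-! ### The Gauss–Green formula -/

section GlobalGaussGreen

open scoped Manifold

variable {m : ℕ} {G : Type*} [NormedAddCommGroup G] [NormedSpace ℝ G]
  {V : Set (EuclideanSpace ℝ (Fin (m + 1)))}
  {θ : EuclideanSpace ℝ (Fin (m + 1)) → EuclideanSpace ℝ (Fin (m + 1)) →L[ℝ] G}

local notation "W" => EuclideanSpace ℝ (Fin m)
local notation "E" => EuclideanSpace ℝ (Fin (m + 1))

theorem formDiv_smul {χ : E → ℝ} {y : E} (hχ : DifferentiableAt ℝ χ y)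
    (hθ : DifferentiableAt ℝ θ y) :
    formDiv (fun y => χ y • θ y) y = χ y • formDiv θ y +
      ∑ i, fderiv ℝ χ y (EuclideanSpace.single i 1) • θ y (EuclideanSpace.single i 1) := by
  simp only [formDiv, fderiv_fun_smul hχ hθ, Finset.smul_sum, ← Finset.sum_add_distrib]
  rfl

/-- The case of the Gauss–Green formula without boundary term. -/
theorem setIntegral_formDiv_eq_zero {K : Set E} (hVo : IsOpen V) (hK : IsCompact K) (hKV : K ⊆ V)
    (hθ : ContDiffOn ℝ 1 θ V) (h0 : ∀ y ∉ K, θ y = 0) : ∫ y in V, formDiv θ y = 0 := by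
  have hθ' : ContDiff ℝ 1 θ := by
    rw [contDiff_iff_contDiffAt]
    intro y
    by_cases hy : y ∈ K
    · exact hθ.contDiffAt (hVo.mem_nhds (hKV hy))
    · refine (contDiffAt_const (c := (0 : E →L[ℝ] G))).congr_of_eventuallyEq ?_
      filter_upwards [hK.isClosed.isOpen_compl.mem_nhds hy] with x hx using h0 x hx
  have hcs : HasCompactSupport θ := HasCompactSupport.intro hK h0
  rw [setIntegral_eq_integral_of_forall_compl_eq_zero fun y hy =>
    formDiv_eq_zero_of_notMem hK h0 fun h => hy (hKV h)]
  unfold formDiv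
  have hd : ∀ (v : E) y, fderiv ℝ (fun y => θ y v) y v = fderiv ℝ θ y v v := fun v y => by
    have := ((ContinuousLinearMap.apply ℝ G v).hasFDerivAt.comp y
      (hθ'.differentiable one_ne_zero y).hasFDerivAt).fderiv
    rw [Function.comp_def] at this
    exact congrArg (fun A => A v) this
  have hv1 : ∀ v : E, ContDiff ℝ 1 fun y => θ y v := fun v => hθ'.clm_apply contDiff_const
  have hv2 : ∀ v : E, HasCompactSupport fun y => θ y v := fun v =>
    HasCompactSupport.intro hK fun y hy => by rw [h0 y hy]; rfl
  simp_rw [← hd]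
  rw [integral_finsetSum _ fun i _ =>
    (((hv1 _).continuous_fderiv one_ne_zero).clm_apply
      continuous_const).integrable_of_hasCompactSupport ((hv2 _).fderiv_apply (𝕜 := ℝ) _)]
  exact Finset.sum_eq_zero fun i _ =>
    integral_fderiv_eq_zero_of_hasCompactSupport volume (hv1 _) (hv2 _) _

theorem integrableOn_formDiv_smul (hVo : IsOpen V) (hVb : Bornology.IsBounded V)
    (hθ : ContDiffOn ℝ 1 θ V) (hθc : ContinuousOn θ (closure V))
    (hdiv : IntegrableOn (formDiv θ) V) {χ : E → ℝ} (hχ : ContDiff ℝ 1 χ) :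
    IntegrableOn (formDiv fun y => χ y • θ y) V := by
  have hcl := hVb.isCompact_closure
  have h1 : IntegrableOn (fun y => χ y • formDiv θ y) V := by
    obtain ⟨C, hC⟩ := hcl.exists_bound_of_continuousOn hχ.continuous.continuousOn
    exact hdiv.bdd_smul C hχ.continuous.aestronglyMeasurable
      ((ae_restrict_iff' hVo.measurableSet).2 (.of_forall fun y hy => hC y (subset_closure hy)))
  have h2 : IntegrableOn (fun y => ∑ i, fderiv ℝ χ y (EuclideanSpace.single i 1) •
      θ y (EuclideanSpace.single i 1)) V := by
    refine IntegrableOn.mono_set (ContinuousOn.integrableOn_compact hcl ?_) subset_closure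
    refine continuousOn_finsetSum _ fun i _ => ?_
    exact ((hχ.continuous_fderiv one_ne_zero).clm_apply continuous_const).continuousOn.smul
      (hθc.clm_apply continuousOn_const)
  refine (h1.add h2).congr_fun (fun y hy => ?_) hVo.measurableSet
  exact (formDiv_smul (hχ.differentiable one_ne_zero y)
    ((hθ.contDiffAt (hVo.mem_nhds hy)).differentiableAt one_ne_zero)).symm

/-- The defect in the Gauss–Green formula is at most an arbitrarily small multiple of the mass of
the form on the boundary: localize by a partition of unity subordinate to balls that are either
interior or almost flat. -/
theorem HasSmoothBoundary.norm_integral_formDiv_sub_le [CompleteSpace G]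
    (hV : HasSmoothBoundary V) (hVo : IsOpen V) (hVb : Bornology.IsBounded V)
    (hθ : ContDiffOn ℝ 1 θ V) (hθc : ContinuousOn θ (closure V))
    (hdiv : IntegrableOn (formDiv θ) V) {ε : ℝ≥0} (hε : 0 < ε) :
    ‖(∫ y in V, formDiv θ y) -
        ∫ y in frontier V, θ y (exteriorUnitNormal V y) ∂Measure.euclideanHausdorffMeasure m‖ ≤
      (2 * ε + ((1 + ε) ^ m - 1)) *
        ∫ y in frontier V, ‖θ y‖ ∂Measure.euclideanHausdorffMeasure m := by
  have hcl := hVb.isCompact_closure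
  have hball : ∀ y ∈ closure V, ∃ r > 0, ball y r ⊆ V ∨
      ∃ (L : WithLp 2 (W × ℝ) ≃ₗᵢ[ℝ] E) (h : W → ℝ), IsAlmostFlatBall V y L h ε r := by
    intro y hy
    by_cases hyV : y ∈ V
    · obtain ⟨r, hr, h⟩ := Metric.isOpen_iff.1 hVo y hyV
      exact ⟨r, hr, .inl h⟩
    · obtain ⟨L, h, r, hr, hB⟩ := hV.exists_isAlmostFlatBall
        (by rw [hVo.frontier_eq]; exact ⟨hy, hyV⟩) hε
      exact ⟨r, hr, .inr ⟨L, h, hB⟩⟩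
  choose! r hr hrB using hball
  obtain ⟨t, htV, ht⟩ := hcl.elim_nhds_subcover (fun y => ball y (r y)) fun y hy =>
    ball_mem_nhds y (hr y hy)
  obtain ⟨ρ, hρ⟩ := SmoothPartitionOfUnity.exists_isSubordinate 𝓘(ℝ, E)
    (isClosed_closure (s := V)) (fun y : t => ball (y : E) (r y)) (fun _ => isOpen_ball)
    (fun x hx => by
      obtain ⟨y, hy, hxy⟩ := mem_iUnion₂.1 (ht hx)
      exact mem_iUnion.2 ⟨⟨y, hy⟩, hxy⟩)
  have hρ1 : ∀ x ∈ closure V, ∑ i, ρ i x = 1 := fun x hx => by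
    rw [← finsum_eq_sum_of_fintype]; exact ρ.sum_eq_one hx
  have hρd : ∀ i, ContDiff ℝ 1 (ρ i) := fun i => ((ρ i).contMDiff.contDiff).of_le (by simp)
  have hρ0 : ∀ i, ∀ y ∉ tsupport (ρ i), ρ i y • θ y = 0 := fun i y hy => by
    rw [image_eq_zero_of_notMem_tsupport hy, zero_smul]
  have hρc : ∀ i, IsCompact (tsupport (ρ i)) := fun i =>
    (isCompact_closedBall (i : E) (r i)).of_isClosed_subset (isClosed_tsupport _)
      ((hρ i).trans ball_subset_closedBall)
  have hθf : ContinuousOn θ (frontier V) := hθc.mono frontier_subset_closure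
  have hnf := hV.continuousOn_exteriorUnitNormal
  have hρθf : ∀ i, ContinuousOn (fun y => ρ i y • θ y) (frontier V) := fun i =>
    (hρd i).continuous.continuousOn.smul hθf
  have hdi := fun i => integrableOn_formDiv_smul hVo hVb hθ hθc hdiv (hρd i)
  have hc : (0 : ℝ) ≤ 2 * ε + ((1 + ε) ^ m - 1) :=
    add_nonneg (by positivity) (sub_nonneg.2 (one_le_pow₀ (by simp)))
  have hlocal : ∀ i, ‖(∫ y in V, formDiv (fun y => ρ i y • θ y) y) -
        ∫ y in frontier V, (ρ i y • θ y) (exteriorUnitNormal V y)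
          ∂Measure.euclideanHausdorffMeasure m‖ ≤
      (2 * ε + ((1 + ε) ^ m - 1)) *
        ∫ y in frontier V, ‖ρ i y • θ y‖ ∂Measure.euclideanHausdorffMeasure m := by
    intro i
    have hθi : ContDiffOn ℝ 1 (fun y => ρ i y • θ y) V := (hρd i).contDiffOn.smul hθ
    rcases hrB i (htV i i.2) with hin | ⟨L, h, hB⟩
    · rw [setIntegral_formDiv_eq_zero hVo (hρc i) ((hρ i).trans hin) hθi (hρ0 i),
        setIntegral_eq_zero_of_forall_eq_zero fun y hy => ?_, sub_zero, norm_zero]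
      · exact mul_nonneg hc (integral_nonneg fun _ => norm_nonneg _)
      · have : y ∉ tsupport (ρ i) := fun hyt => by
          rw [hVo.frontier_eq] at hy
          exact hy.2 (hin (hρ i hyt))
        rw [hρ0 i y this]; rfl
    · exact hB.norm_integral_formDiv_sub_le hV hVo hVb (hρc i) (hρ i) hθi
        ((hρd i).continuous.continuousOn.smul hθc) (hρ0 i) (hdi i)
  have e1 : ∫ y in V, formDiv θ y = ∑ i, ∫ y in V, formDiv (fun y => ρ i y • θ y) y := by
    rw [← integral_finsetSum _ fun i _ => hdi i]
    refine setIntegral_congr_fun hVo.measurableSet fun y hy => ?_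
    have hθd := (hθ.contDiffAt (hVo.mem_nhds hy)).differentiableAt one_ne_zero
    have hsum : (fun y => ∑ i, ρ i y • θ y) =ᶠ[𝓝 y] θ := by
      filter_upwards [hVo.mem_nhds hy] with x hx
      rw [← Finset.sum_smul, hρ1 x (subset_closure hx), one_smul]
    have hfd := hsum.fderiv_eq (𝕜 := ℝ)
    have hd : ∀ i, DifferentiableAt ℝ (fun y => ρ i y • θ y) y := fun i =>
      ((hρd i).differentiable one_ne_zero y).smul hθd
    rw [fderiv_fun_sum fun i _ => hd i] at hfd
    simp only [formDiv]
    rw [Finset.sum_comm, ← hfd]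
    simp only [_root_.sum_apply]
  have e2 : ∫ y in frontier V, θ y (exteriorUnitNormal V y)
        ∂Measure.euclideanHausdorffMeasure m =
      ∑ i, ∫ y in frontier V, (ρ i y • θ y) (exteriorUnitNormal V y)
        ∂Measure.euclideanHausdorffMeasure m := by
    rw [← integral_finsetSum _ fun i _ => hV.integrableOn_frontier hVo hVb
      ((hρθf i).clm_apply hnf)]
    refine setIntegral_congr_fun isClosed_frontier.measurableSet fun y hy => ?_
    simp only [_root_.smul_apply, ← Finset.sum_smul, hρ1 y (frontier_subset_closure hy), one_smul]
  have e3 : ∫ y in frontier V, ‖θ y‖ ∂Measure.euclideanHausdorffMeasure m =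
      ∑ i, ∫ y in frontier V, ‖ρ i y • θ y‖ ∂Measure.euclideanHausdorffMeasure m := by
    rw [← integral_finsetSum _ fun i _ => hV.integrableOn_frontier hVo hVb
      (hρθf i).norm]
    refine setIntegral_congr_fun isClosed_frontier.measurableSet fun y hy => ?_
    simp only [norm_smul, Real.norm_eq_abs, abs_of_nonneg (ρ.nonneg _ y), ← Finset.sum_mul,
      hρ1 y (frontier_subset_closure hy), one_mul]
  rw [e1, e2, e3, ← Finset.sum_sub_distrib, Finset.mul_sum]
  exact (norm_sum_le _ _).trans (Finset.sum_le_sum fun i _ => hlocal i)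

/-- The **Gauss–Green formula** on a bounded open set with smooth boundary, for a linear form
field that is `C¹` inside, continuous up to the boundary and has integrable divergence. -/
theorem HasSmoothBoundary.setIntegral_formDiv [CompleteSpace G]
    (hV : HasSmoothBoundary V) (hVo : IsOpen V) (hVb : Bornology.IsBounded V)
    (hθ : ContDiffOn ℝ 1 θ V) (hθc : ContinuousOn θ (closure V))
    (hdiv : IntegrableOn (formDiv θ) V) :
    ∫ y in V, formDiv θ y =
      ∫ y in frontier V, θ y (exteriorUnitNormal V y) ∂Measure.euclideanHausdorffMeasure m := by
  set M := ∫ y in frontier V, ‖θ y‖ ∂(Measure.euclideanHausdorffMeasure m : Measure E)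
  have hlim : Tendsto (fun ε : ℝ => (2 * ε + ((1 + ε) ^ m - 1)) * M) (𝓝[>] 0) (𝓝 0) := by
    have : Continuous fun ε : ℝ => (2 * ε + ((1 + ε) ^ m - 1)) * M := by fun_prop
    simpa using (this.tendsto 0).mono_left nhdsWithin_le_nhds
  refine sub_eq_zero.1 (norm_le_zero_iff.1 (ge_of_tendsto hlim ?_))
  filter_upwards [self_mem_nhdsWithin] with ε hε
  lift ε to ℝ≥0 using le_of_lt hε
  exact hV.norm_integral_formDiv_sub_le hVo hVb hθ hθc hdiv (by exact_mod_cast hε)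

end GlobalGaussGreen

/-! ### An approximate identity from a radial cutoff -/

section Cutoff

/-- A smooth monotone function on the line that vanishes on `(-∞, 1/2]` and is `1` on `[1, ∞)`. -/
def cutoff (t : ℝ) : ℝ := Real.smoothTransition (2 * t - 1)

theorem contDiff_cutoff : ContDiff ℝ 1 cutoff :=
  Real.smoothTransition.contDiff.comp (by fun_prop)

theorem monotone_cutoff : Monotone cutoff := fun a b hab =>
  Real.smoothTransition.monotone (by linarith)

theorem cutoff_of_le {t : ℝ} (ht : t ≤ 1 / 2) : cutoff t = 0 :=
  Real.smoothTransition.zero_of_nonpos (by linarith)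

theorem cutoff_of_ge {t : ℝ} (ht : 1 ≤ t) : cutoff t = 1 :=
  Real.smoothTransition.one_of_one_le (by linarith)

theorem deriv_cutoff_nonneg (t : ℝ) : 0 ≤ deriv cutoff t :=
  monotone_cutoff.deriv_nonneg

theorem deriv_cutoff_of_gt {t : ℝ} (ht : 1 < t) : deriv cutoff t = 0 := by
  have : cutoff =ᶠ[𝓝 t] fun _ => 1 := by
    filter_upwards [lt_mem_nhds ht] with s hs using cutoff_of_ge hs.le
  rw [this.deriv_eq, deriv_const]

/-- The radial profile of `∇χ · K`, for `χ(z) = cutoff (|z|² / ε²)` and `K(z) = c z / |z|^{m+1}`. -/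
def cutoffDensity (m : ℕ) (c ε r : ℝ) : ℝ :=
  c / r ^ (m + 1) * (deriv cutoff (r ^ 2 / ε ^ 2) * (2 / ε ^ 2) * r ^ 2)

variable {m : ℕ} {c ε : ℝ}

theorem cutoffDensity_nonneg (hc : 0 ≤ c) {r : ℝ} (hr : 0 ≤ r) : 0 ≤ cutoffDensity m c ε r := by
  have := deriv_cutoff_nonneg (r ^ 2 / ε ^ 2)
  unfold cutoffDensity; positivity

theorem cutoffDensity_of_gt (hε : 0 < ε) {r : ℝ} (hr : ε < r) : cutoffDensity m c ε r = 0 := by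
  have : 1 < r ^ 2 / ε ^ 2 := by
    rw [one_lt_div (by positivity)]; exact pow_lt_pow_left₀ hr hε.le two_ne_zero
  simp [cutoffDensity, deriv_cutoff_of_gt this]

theorem hasDerivAt_cutoff_sq (r : ℝ) : HasDerivAt (fun r => c * cutoff (r ^ 2 / ε ^ 2))
    (c * (deriv cutoff (r ^ 2 / ε ^ 2) * (2 * r / ε ^ 2))) r := by
  have h1 : HasDerivAt cutoff (deriv cutoff (r ^ 2 / ε ^ 2)) (r ^ 2 / ε ^ 2) :=
    (contDiff_cutoff.differentiable one_ne_zero _).hasDerivAt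
  have h2 : HasDerivAt (fun r : ℝ => r ^ 2 / ε ^ 2) (2 * r / ε ^ 2) r := by
    simpa using (hasDerivAt_pow 2 r).div_const (ε ^ 2)
  exact (h1.comp r h2).const_mul c

/-- The density times the Jacobian of polar coordinates is the derivative of `c cutoff(r² / ε²)`. -/
theorem pow_mul_cutoffDensity {r : ℝ} (hr : 0 < r) : r ^ m * cutoffDensity m c ε r =
    c * (deriv cutoff (r ^ 2 / ε ^ 2) * (2 * r / ε ^ 2)) := by
  unfold cutoffDensity
  field_simp
  ring

theorem tendsto_cutoff_sq (hε : 0 < ε) :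
    Tendsto (fun r : ℝ => c * cutoff (r ^ 2 / ε ^ 2)) atTop (𝓝 c) := by
  refine tendsto_const_nhds.congr' ?_
  filter_upwards [eventually_ge_atTop ε] with r hr
  rw [cutoff_of_ge, mul_one]
  rw [one_le_div (by positivity)]
  exact pow_le_pow_left₀ hε.le hr 2

local notation "E" => EuclideanSpace ℝ (Fin (m + 1))

theorem integrable_cutoffDensity (hc : 0 ≤ c) (hε : 0 < ε) :
    Integrable fun z : E => cutoffDensity m c ε ‖z‖ := by
  rw [integrable_fun_norm_addHaar (volume : Measure E) (f := cutoffDensity m c ε),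
    finrank_euclideanSpace_fin, Nat.add_sub_cancel]
  refine (integrableOn_Ioi_deriv_of_nonneg' (fun r _ => hasDerivAt_cutoff_sq (c := c) (ε := ε) r)
    (fun r hr => ?_) (tendsto_cutoff_sq hε)).congr_fun (fun r hr => ?_) measurableSet_Ioi
  · have := deriv_cutoff_nonneg (r ^ 2 / ε ^ 2)
    have hr' : 0 < r := hr
    positivity
  · exact (pow_mul_cutoffDensity hr).symm

/-- Polar coordinates turn the density into the derivative of `c cutoff(r² / ε²)`, which rises from
`0` to `c`; the other factor is the area of the unit sphere. -/
theorem integral_cutoffDensity (hc : 0 ≤ c) (hε : 0 < ε) :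
    ∫ z : E, cutoffDensity m c ε ‖z‖ = (m + 1) * volume.real (ball (0 : E) 1) * c := by
  rw [integral_fun_norm_addHaar (volume : Measure E) (cutoffDensity m c ε),
    finrank_euclideanSpace_fin, Nat.add_sub_cancel]
  have h1 : ∫ r in Ioi (0 : ℝ), r ^ m • cutoffDensity m c ε r = c := by
    have hcongr : EqOn (fun r : ℝ => r ^ m • cutoffDensity m c ε r)
        (fun r => c * (deriv cutoff (r ^ 2 / ε ^ 2) * (2 * r / ε ^ 2))) (Ioi 0) :=
      fun r hr => pow_mul_cutoffDensity hr
    rw [setIntegral_congr_fun measurableSet_Ioi hcongr,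
      integral_Ioi_of_hasDerivAt_of_nonneg' (fun r _ => hasDerivAt_cutoff_sq (c := c) (ε := ε) r)
        (fun r hr => ?_) (tendsto_cutoff_sq hε)]
    · rw [cutoff_of_le (by norm_num)]; simp
    · have := deriv_cutoff_nonneg (r ^ 2 / ε ^ 2)
      have hr' : 0 < r := hr
      positivity
  rw [h1]
  simp [mul_assoc]

/-- The densities form an approximate identity. -/
theorem tendsto_setIntegral_cutoffDensity_smul {G : Type*} [NormedAddCommGroup G]
    [NormedSpace ℝ G] [CompleteSpace G] (hc : 0 ≤ c)
    (hc1 : (m + 1) * volume.real (ball (0 : E) 1) * c = 1) {V : Set E} (hVo : IsOpen V) {f : E → G}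
    (hf : ContinuousOn f V) {x : E} (hx : x ∈ V) :
    Tendsto (fun ε => ∫ y in V, cutoffDensity m c ε ‖y - x‖ • f y) (𝓝[>] 0) (𝓝 (f x)) := by
  rw [Metric.tendsto_nhds]
  intro η hη
  obtain ⟨R, hR, hRV⟩ := Metric.isOpen_iff.1 hVo x hx
  obtain ⟨δ, hδ, hfδ⟩ := Metric.continuousAt_iff.1 (hf.continuousAt (hVo.mem_nhds hx)) (η / 2)
    (by positivity)
  filter_upwards [Ioo_mem_nhdsGT (lt_min hR hδ)] with ε hε
  have hε0 : 0 < ε := hε.1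
  have hzero : ∀ y, y ∉ ball x (min R δ) → cutoffDensity m c ε ‖y - x‖ = 0 := fun y hy => by
    refine cutoffDensity_of_gt hε0 (hε.2.trans_le ?_)
    rwa [mem_ball_iff_norm, not_lt] at hy
  have hi : Integrable fun y : E => cutoffDensity m c ε ‖y - x‖ :=
    (integrable_cutoffDensity hc hε0).comp_sub_right x
  have hone : ∫ y in V, cutoffDensity m c ε ‖y - x‖ = 1 := by
    rw [setIntegral_eq_integral_of_forall_compl_eq_zero fun y hy =>
      hzero y fun h => hy (hRV (ball_subset_ball (min_le_left _ _) h)),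
      integral_sub_right_eq_self (fun z : E => cutoffDensity m c ε ‖z‖),
      integral_cutoffDensity hc hε0, hc1]
  have hbound : ∀ y ∈ V, ‖cutoffDensity m c ε ‖y - x‖ • (f y - f x)‖ ≤
      cutoffDensity m c ε ‖y - x‖ * (η / 2) := fun y hy => by
    rw [norm_smul, Real.norm_of_nonneg (cutoffDensity_nonneg hc (norm_nonneg _))]
    by_cases hyb : y ∈ ball x (min R δ)
    · refine mul_le_mul_of_nonneg_left ?_ (cutoffDensity_nonneg hc (norm_nonneg _))
      rw [← dist_eq_norm]
      exact (hfδ (lt_of_lt_of_le hyb (min_le_right _ _))).le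
    · rw [hzero y hyb]; simp
  have hi1 : IntegrableOn (fun y => cutoffDensity m c ε ‖y - x‖ • (f y - f x)) V := by
    refine Integrable.mono' (hi.integrableOn.mul_const (η / 2))
      (hi.integrableOn.aestronglyMeasurable.smul
        ((hf.sub continuousOn_const).aestronglyMeasurable hVo.measurableSet))
      ((ae_restrict_iff' hVo.measurableSet).2 (.of_forall hbound))
  have hi2 : IntegrableOn (fun y => cutoffDensity m c ε ‖y - x‖ • f x) V :=
    hi.integrableOn.smul_const _
  have hsplit : ∫ y in V, cutoffDensity m c ε ‖y - x‖ • f y =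
      (∫ y in V, cutoffDensity m c ε ‖y - x‖ • (f y - f x)) + f x := by
    have h1 : ∫ y in V, cutoffDensity m c ε ‖y - x‖ • f x = f x := by
      rw [integral_smul_const, hone, one_smul]
    have h2 := integral_add hi1 hi2
    rw [h1] at h2
    rw [← h2]
    simp [← smul_add]
  rw [hsplit, dist_eq_norm, add_sub_cancel_right]
  calc _ ≤ ∫ y in V, cutoffDensity m c ε ‖y - x‖ * (η / 2) :=
        norm_integral_le_of_norm_le (hi.integrableOn.mul_const _)
          ((ae_restrict_iff' hVo.measurableSet).2 (.of_forall hbound))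
    _ = η / 2 := by rw [integral_mul_const, hone, one_mul]
    _ < η := half_lt_self hη

end Cutoff

/-! ### The kernel form and its divergence -/

section CauchyPompeiu

variable {m : ℕ} {G : Type*} [NormedAddCommGroup G] [NormedSpace ℝ G]
  {κ α : EuclideanSpace ℝ (Fin (m + 1)) →L[ℝ] G →L[ℝ] G} {c : ℝ}
  {V : Set (EuclideanSpace ℝ (Fin (m + 1)))} {f : EuclideanSpace ℝ (Fin (m + 1)) → G}
  {x : EuclideanSpace ℝ (Fin (m + 1))}

local notation "E" => EuclideanSpace ℝ (Fin (m + 1))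

/-- The gradient `c z / |z|^{m+1}` of a multiple of the fundamental solution of the Laplacian;
its value at the origin is `0`. -/
def newtonKernel (c : ℝ) (z : E) : E := (c / ‖z‖ ^ (m + 1)) • z

theorem newtonKernel_zero : newtonKernel c (0 : E) = 0 := by simp [newtonKernel]

theorem norm_newtonKernel (hc : 0 ≤ c) (z : E) :
    ‖newtonKernel c z‖ = c / ‖z‖ ^ (m + 1) * ‖z‖ := by
  rw [newtonKernel, norm_smul, Real.norm_of_nonneg (by positivity)]

theorem hasFDerivAt_newtonKernel {z : E} (hz : z ≠ 0) : HasFDerivAt (newtonKernel c)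
    ((c / ‖z‖ ^ (m + 1)) • ContinuousLinearMap.id ℝ E -
      ((m + 1) * (c / ‖z‖ ^ (m + 1)) / ‖z‖ ^ 2) • (innerSL ℝ z).smulRight z) z := by
  have hz' : ‖z‖ ≠ 0 := norm_ne_zero_iff.2 hz
  have h1 : HasFDerivAt (fun z : E => ‖z‖) (‖z‖⁻¹ • innerSL ℝ z) z := by
    have := (hasStrictFDerivAt_norm_sq z).hasFDerivAt.sqrt (by positivity)
    simp only [Real.sqrt_sq (norm_nonneg _)] at this
    refine this.congr_fderiv ?_
    ext1 v
    simp
    field_simp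
  have h2 : HasDerivAt (fun r : ℝ => c / r ^ (m + 1))
      (-((m + 1) * (c / ‖z‖ ^ (m + 1)) / ‖z‖)) ‖z‖ := by
    have := (hasDerivAt_const ‖z‖ c).div (hasDerivAt_pow (m + 1) ‖z‖) (pow_ne_zero _ hz')
    refine this.congr_deriv ?_
    push_cast
    field_simp
    ring
  have h3 := (h2.comp_hasFDerivAt z h1).smul (hasFDerivAt_id z)
  refine h3.congr_fderiv ?_
  ext1 v
  simp [sub_eq_add_neg, smul_smul]
  congr 2
  field_simp

theorem contDiffOn_newtonKernel : ContDiffOn ℝ 1 (newtonKernel (m := m) c) {0}ᶜ := by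
  intro z hz
  have hz' : z ≠ 0 := hz
  unfold newtonKernel
  exact ((contDiffAt_const.div ((contDiffAt_norm ℝ hz').pow _)
    (pow_ne_zero _ (norm_ne_zero_iff.2 hz'))).smul contDiffAt_id).contDiffWithinAt

theorem measurable_newtonKernel : Measurable (newtonKernel (m := m) c) := by
  unfold newtonKernel
  fun_prop

theorem sum_inner_single_smul (z : E) : ∑ i, inner ℝ z (EuclideanSpace.single i (1 : ℝ)) •
    EuclideanSpace.single i (1 : ℝ) = z := by
  have := (EuclideanSpace.basisFun (Fin (m + 1)) ℝ).sum_repr' z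
  simpa [real_inner_comm] using this

/-- The first order operator `∑ α(e_i) ∂_i` with constant coefficients. -/
def symbolOp (α : E →L[ℝ] G →L[ℝ] G) (f : E → G) (y : E) : G :=
  ∑ i, α (EuclideanSpace.single i 1) (fderiv ℝ f y (EuclideanSpace.single i 1))

/-- The `G`-valued form `v ↦ κ(K(y - x)) (α(v) f(y))`, where `K` is the Newton kernel. -/
def kernelForm (κ α : E →L[ℝ] G →L[ℝ] G) (c : ℝ) (x : E) (f : E → G) (y : E) : E →L[ℝ] G :=
  κ (newtonKernel c (y - x)) ∘L α.flip (f y)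

theorem kernelForm_apply (v y : E) :
    kernelForm κ α c x f y v = κ (newtonKernel c (y - x)) (α v (f y)) := rfl

/-- The identity `κ(v) α(v) = |v|²` makes the divergence of the kernel form act on `f` only: the
derivative of the kernel at `z` is `v ↦ s (v - (m+1) ⟪z, v⟫ z / |z|²)`, and its contributions
`(m+1) s f` and `-(m+1) s f` cancel. -/
theorem formDiv_kernelForm (hκα : ∀ v g, κ v (α v g) = ‖v‖ ^ 2 • g) {y : E} (hy : y ≠ x)
    (hf : DifferentiableAt ℝ f y) :
    formDiv (kernelForm κ α c x f) y = κ (newtonKernel c (y - x)) (symbolOp α f y) := by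
  set z := y - x with hz
  have hz0 : z ≠ 0 := sub_ne_zero.2 hy
  have hK := (hasFDerivAt_newtonKernel (c := c) hz0).comp (f := fun y => y - x) y
    ((hasFDerivAt_id y).sub_const x)
  have hform : HasFDerivAt (kernelForm κ α c x f) _ y :=
    (κ.hasFDerivAt.comp y hK).clm_comp (α.flip.hasFDerivAt.comp y hf.hasFDerivAt)
  set s := c / ‖z‖ ^ (m + 1) with hs
  have hv : ∀ v, fderiv ℝ (kernelForm κ α c x f) y v v = s • ‖v‖ ^ 2 • f y -
      ((m + 1) * s / ‖z‖ ^ 2) • κ z (α (inner ℝ z v • v) (f y)) +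
        κ (newtonKernel c z) (α v (fderiv ℝ f y v)) := by
    intro v
    rw [hform.fderiv]
    simp [hκα, smul_smul, ← hz, Function.comp_def]
    abel
  have hmid : ∑ i, κ z (α (inner ℝ z (EuclideanSpace.single i (1 : ℝ)) •
      EuclideanSpace.single i (1 : ℝ)) (f y)) = ‖z‖ ^ 2 • f y := by
    rw [← map_sum, ← _root_.sum_apply, ← map_sum, sum_inner_single_smul, hκα]
  simp only [formDiv, hv, Finset.sum_add_distrib, Finset.sum_sub_distrib, ← Finset.smul_sum, hmid,
    symbolOp, map_sum]
  rw [add_eq_right, sub_eq_zero, smul_smul, div_mul_cancel₀ _ (by positivity)]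
  simp [smul_smul, mul_comm, ← Nat.cast_smul_eq_nsmul ℝ]

theorem contDiffAt_kernelForm {y : E} (hy : y ≠ x) (hf : ContDiffAt ℝ 1 f y) :
    ContDiffAt ℝ 1 (kernelForm κ α c x f) y := by
  have h1 : ContDiffAt ℝ 1 (newtonKernel (m := m) c) (y - x) :=
    contDiffOn_newtonKernel.contDiffAt (isOpen_compl_singleton.mem_nhds (sub_ne_zero.2 hy))
  have h2 : ContDiffAt ℝ 1 (fun y => newtonKernel c (y - x)) y :=
    ContDiffAt.comp (f := fun y => y - x) (g := newtonKernel c) y h1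
      (contDiffAt_id.sub contDiffAt_const)
  exact (κ.contDiff.contDiffAt.comp y h2).clm_comp (α.flip.contDiff.contDiffAt.comp y hf)

theorem continuousWithinAt_kernelForm {S : Set E} {y : E} (hy : y ≠ x)
    (hf : ContinuousWithinAt f S y) : ContinuousWithinAt (kernelForm κ α c x f) S y := by
  have h1 : ContinuousAt (newtonKernel (m := m) c) (y - x) :=
    contDiffOn_newtonKernel.continuousOn.continuousAt
      (isOpen_compl_singleton.mem_nhds (sub_ne_zero.2 hy))
  have h2 : ContinuousAt (fun y => newtonKernel c (y - x)) y :=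
    ContinuousAt.comp (f := fun y => y - x) h1 (continuousAt_id.sub continuousAt_const)
  exact (κ.continuous.continuousAt.comp h2).continuousWithinAt.clm_comp
    (α.flip.continuous.continuousAt.comp_continuousWithinAt hf)

theorem contDiff_cutoff_sub {ε : ℝ} :
    ContDiff ℝ 1 fun y : E => cutoff (‖y - x‖ ^ 2 / ε ^ 2) :=
  contDiff_cutoff.comp (((contDiff_id.sub contDiff_const).norm_sq ℝ).div_const _)

theorem eventually_cutoff_sub_eq_zero {ε : ℝ} :
    ∀ᶠ y : E in 𝓝 x, cutoff (‖y - x‖ ^ 2 / ε ^ 2) = 0 := by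
  have hc : Continuous fun y : E => ‖y - x‖ ^ 2 / ε ^ 2 := by fun_prop
  have ht : ∀ᶠ y : E in 𝓝 x, ‖y - x‖ ^ 2 / ε ^ 2 < 1 / 2 :=
    (hc.tendsto x).eventually_lt_const (by simp)
  filter_upwards [ht] with y hy
  exact cutoff_of_le hy.le

theorem fderiv_cutoff_sub {ε : ℝ} (y v : E) :
    fderiv ℝ (fun y : E => cutoff (‖y - x‖ ^ 2 / ε ^ 2)) y v =
      deriv cutoff (‖y - x‖ ^ 2 / ε ^ 2) * (2 / ε ^ 2) * inner ℝ (y - x) v := by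
  have h1 : HasDerivAt cutoff (deriv cutoff (‖y - x‖ ^ 2 / ε ^ 2)) (‖y - x‖ ^ 2 / ε ^ 2) :=
    (contDiff_cutoff.differentiable one_ne_zero _).hasDerivAt
  have h2 := ((hasFDerivAt_id y).sub_const x).norm_sq.mul_const (ε ^ 2)⁻¹
  have h3 := h1.comp_hasFDerivAt (f := fun y : E => ‖y - x‖ ^ 2 / ε ^ 2) y
    (by simpa only [div_eq_mul_inv, id] using h2)
  have h4 := h3.fderiv
  rw [Function.comp_def] at h4
  rw [h4]
  simp [inner_sub_left]
  ring

/-- Truncating the kernel form near its singularity adds to the divergence a term concentrated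
near `x`, which by `κ(v) α(v) = |v|²` is a scalar multiple of `f`. -/
theorem formDiv_cutoff_kernelForm (hκα : ∀ v g, κ v (α v g) = ‖v‖ ^ 2 • g) {ε : ℝ}
    {y : E} (hf : ContDiffAt ℝ 1 f y) :
    formDiv (fun y => cutoff (‖y - x‖ ^ 2 / ε ^ 2) • kernelForm κ α c x f y) y =
      cutoff (‖y - x‖ ^ 2 / ε ^ 2) • κ (newtonKernel c (y - x)) (symbolOp α f y) +
        cutoffDensity m c ε ‖y - x‖ • f y := by
  by_cases hy : y = x
  · rw [hy]
    have h0 : (fun y => cutoff (‖y - x‖ ^ 2 / ε ^ 2) • kernelForm κ α c x f y) =ᶠ[𝓝 x]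
        fun _ => 0 := by
      filter_upwards [eventually_cutoff_sub_eq_zero] with z hz
      rw [hz, zero_smul]
    simp [formDiv, h0.fderiv_eq, newtonKernel_zero, cutoffDensity]
  · rw [formDiv_smul (contDiff_cutoff_sub.differentiable one_ne_zero y)
      ((contDiffAt_kernelForm hy hf).differentiableAt one_ne_zero),
      formDiv_kernelForm hκα hy (hf.differentiableAt one_ne_zero)]
    congr 1
    set z := y - x
    have hmid : ∑ i, κ z (α (inner ℝ z (EuclideanSpace.single i (1 : ℝ)) •
        EuclideanSpace.single i (1 : ℝ)) (f y)) = ‖z‖ ^ 2 • f y := by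
      rw [← map_sum, ← _root_.sum_apply, ← map_sum, sum_inner_single_smul, hκα]
    have hd : cutoffDensity m c ε ‖z‖ • f y =
        (c / ‖z‖ ^ (m + 1) * (deriv cutoff (‖z‖ ^ 2 / ε ^ 2) * (2 / ε ^ 2))) • ‖z‖ ^ 2 • f y := by
      rw [cutoffDensity, smul_smul]
      congr 1
      ring
    rw [hd, ← hmid, Finset.smul_sum]
    refine Finset.sum_congr rfl fun i _ => ?_
    rw [fderiv_cutoff_sub, kernelForm_apply, newtonKernel]
    simp only [map_smul, _root_.smul_apply, smul_smul]
    congr 1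
    ring

/-! ### The Cauchy–Pompeiu formula for operators with a left inverse symbol -/

theorem integrableOn_newtonKernel_sub (hc : 0 ≤ c) (x : E) (r : ℝ) :
    IntegrableOn (fun y => newtonKernel c (y - x)) (ball x r) := by
  have h0 : IntegrableOn (newtonKernel (m := m) c) (ball 0 r) := by
    have hn : IntegrableOn (fun z : E => c / ‖z‖ ^ (m + 1) * ‖z‖) (ball 0 r) := by
      rw [integrableOn_fun_norm_addHaar (volume : Measure E)
        (f := fun t => c / t ^ (m + 1) * t), finrank_euclideanSpace_fin, Nat.add_sub_cancel]
      have hconst : IntegrableOn (fun _ : ℝ => c) (Ioo 0 r) := by simp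
      refine hconst.congr_fun (fun t ht => ?_) measurableSet_Ioo
      have := ht.1
      simp only [smul_eq_mul]
      field_simp
      ring
    refine (integrable_norm_iff measurable_newtonKernel.aestronglyMeasurable).1 ?_
    simpa only [IntegrableOn, norm_newtonKernel hc] using hn
  have h1 := ((measurePreserving_sub_right (volume : Measure E) x).integrableOn_comp_preimage
    (MeasurableEquiv.subRight x).measurableEmbedding).2 h0
  have hb : ball x r = (fun y => y - x) ⁻¹' ball 0 r := by
    ext y
    simp [dist_eq_norm]
  rw [hb]
  exact h1

theorem norm_newtonKernel_le (hc : 0 ≤ c) {r : ℝ} (hr : 0 < r) {z : E} (hz : r ≤ ‖z‖) :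
    ‖newtonKernel c z‖ ≤ c / r ^ m := by
  have hz0 : 0 < ‖z‖ := hr.trans_le hz
  have : ‖newtonKernel c z‖ = c / ‖z‖ ^ m := by
    rw [norm_newtonKernel hc]
    field_simp
    ring
  rw [this]
  gcongr

/-- The singularity of the Newton kernel is integrable, so near it a continuous factor does no harm;
away from it the kernel is bounded. -/
theorem integrableOn_newtonKernel_apply (hc : 0 ≤ c) (hVo : IsOpen V) {h : E → G}
    (hh : ContinuousOn h V) (hhi : IntegrableOn h V) (hx : x ∈ V) :
    IntegrableOn (fun y => κ (newtonKernel c (y - x)) (h y)) V := by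
  obtain ⟨r, hr, hrV⟩ := nhds_basis_closedBall.mem_iff.1 (hVo.mem_nhds hx)
  obtain ⟨C, hC⟩ := (isCompact_closedBall x r).exists_bound_of_continuousOn (hh.mono hrV)
  have hmeas : AEStronglyMeasurable (fun y => κ (newtonKernel c (y - x)) (h y))
      (volume.restrict V) :=
    κ.aestronglyMeasurable_comp₂
      (measurable_newtonKernel.comp (measurable_id.sub_const x)).aestronglyMeasurable
      hhi.aestronglyMeasurable
  have hsplit : V = ball x r ∪ V \ ball x r :=
    (union_sdiff_cancel (ball_subset_closedBall.trans hrV)).symm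
  rw [hsplit]
  refine IntegrableOn.union ?_ ?_
  · refine Integrable.mono'
      (((integrableOn_newtonKernel_sub hc x r).norm.const_mul ‖κ‖).mul_const C)
      (hmeas.mono_set (ball_subset_closedBall.trans hrV))
      ((ae_restrict_iff' measurableSet_ball).2 (.of_forall fun y hy => ?_))
    exact (κ.le_opNorm₂ _ _).trans
      (mul_le_mul_of_nonneg_left (hC y (ball_subset_closedBall hy)) (by positivity))
  · refine Integrable.mono' ((hhi.mono_set Set.sdiff_subset).norm.const_mul (‖κ‖ * (c / r ^ m)))
      (hmeas.mono_set Set.sdiff_subset)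
      ((ae_restrict_iff' (hVo.measurableSet.diff measurableSet_ball)).2 (.of_forall fun y hy => ?_))
    have hy2 : r ≤ ‖y - x‖ := by
      have := hy.2
      rwa [mem_ball_iff_norm, not_lt] at this
    refine (κ.le_opNorm₂ _ _).trans ?_
    gcongr
    exact norm_newtonKernel_le hc hr hy2

theorem continuousOn_symbolOp (hVo : IsOpen V) (hf : ContDiffOn ℝ 1 f V) :
    ContinuousOn (symbolOp α f) V := by
  unfold symbolOp
  have := hf.continuousOn_fderiv_of_isOpen hVo le_rfl
  fun_prop

/-- The kernel form is continuous on the boundary, which stays away from the singularity. -/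
theorem HasSmoothBoundary.integrableOn_kernelForm (hV : HasSmoothBoundary V) (hVo : IsOpen V)
    (hVb : Bornology.IsBounded V) (hfc : ContinuousOn f (closure V)) (hx : x ∈ V) :
    IntegrableOn (fun y => kernelForm κ α c x f y (exteriorUnitNormal V y)) (frontier V)
      (Measure.euclideanHausdorffMeasure m) := by
  refine hV.integrableOn_frontier hVo hVb
    (ContinuousOn.clm_apply (fun y hy => ?_) hV.continuousOn_exteriorUnitNormal)
  have hyx : y ≠ x := by
    rintro rfl
    rw [hVo.frontier_eq] at hy
    exact hy.2 hx
  exact continuousWithinAt_kernelForm hyx ((hfc.mono frontier_subset_closure) y hy)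

theorem contDiffOn_cutoff_smul_kernelForm {ε : ℝ} (hVo : IsOpen V) (hf : ContDiffOn ℝ 1 f V) :
    ContDiffOn ℝ 1 (fun y => cutoff (‖y - x‖ ^ 2 / ε ^ 2) • kernelForm κ α c x f y) V := by
  intro y hy
  refine ContDiffAt.contDiffWithinAt ?_
  by_cases hyx : y = x
  · rw [hyx]
    refine (contDiffAt_const (c := 0)).congr_of_eventuallyEq ?_
    filter_upwards [eventually_cutoff_sub_eq_zero (x := x) (ε := ε)] with z hz
    rw [hz, zero_smul]
  · exact contDiff_cutoff_sub.contDiffAt.smul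
      (contDiffAt_kernelForm hyx (hf.contDiffAt (hVo.mem_nhds hy)))

theorem continuousOn_cutoff_smul_kernelForm {ε : ℝ} {S : Set E} (hf : ContinuousOn f S) :
    ContinuousOn (fun y => cutoff (‖y - x‖ ^ 2 / ε ^ 2) • kernelForm κ α c x f y) S := by
  intro y hy
  by_cases hyx : y = x
  · rw [hyx]
    refine ContinuousAt.continuousWithinAt ?_
    refine (continuousAt_const (y := 0)).congr ?_
    filter_upwards [eventually_cutoff_sub_eq_zero (x := x) (ε := ε)] with z hz
    rw [hz, zero_smul]
  · exact contDiff_cutoff_sub.continuous.continuousWithinAt.smul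
      (continuousWithinAt_kernelForm hyx (hf y hy))

theorem eventually_cutoff_sub_eq_one {y : E} (hy : y ≠ x) :
    ∀ᶠ ε : ℝ in 𝓝[>] 0, cutoff (‖y - x‖ ^ 2 / ε ^ 2) = 1 := by
  filter_upwards [Ioo_mem_nhdsGT (norm_pos_iff.2 (sub_ne_zero.2 hy))] with ε hε
  have := hε.1
  refine cutoff_of_ge ((one_le_div (by positivity)).2 ?_)
  exact pow_le_pow_left₀ hε.1.le hε.2.le 2

theorem cutoff_mem_Icc (t : ℝ) : cutoff t ∈ Icc (0 : ℝ) 1 :=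
  ⟨Real.smoothTransition.nonneg _, Real.smoothTransition.le_one _⟩

/-- The **Cauchy–Pompeiu formula** for a first order operator `∑ α(e_i) ∂_i` with a left inverse
symbol, `κ(v) α(v) = |v|²`. -/
theorem HasSmoothBoundary.cauchyPompeiu [CompleteSpace G]
    (hκα : ∀ v g, κ v (α v g) = ‖v‖ ^ 2 • g) (hc : 0 ≤ c)
    (hc1 : (m + 1) * volume.real (ball (0 : EuclideanSpace ℝ (Fin (m + 1))) 1) * c = 1)
    (hV : HasSmoothBoundary V) (hVo : IsOpen V) (hVb : Bornology.IsBounded V)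
    (hf : ContDiffOn ℝ 1 f V) (hfc : ContinuousOn f (closure V)) (hx : x ∈ V)
    (hD : IntegrableOn (symbolOp α f) V) :
    f x = (∫ y in frontier V, kernelForm κ α c x f y (exteriorUnitNormal V y)
        ∂Measure.euclideanHausdorffMeasure m) -
      ∫ y in V, κ (newtonKernel c (y - x)) (symbolOp α f y) := by
  set g : E → G := fun y => κ (newtonKernel c (y - x)) (symbolOp α f y) with hg
  have hgi : IntegrableOn g V :=
    integrableOn_newtonKernel_apply hc hVo (continuousOn_symbolOp hVo hf) hD hx
  obtain ⟨C, hC⟩ := hVb.isCompact_closure.exists_bound_of_continuousOn hfc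
  have hfm : AEStronglyMeasurable f (volume.restrict V) :=
    (hfc.mono subset_closure).aestronglyMeasurable hVo.measurableSet
  have hqm : ∀ ε : ℝ, Continuous fun y : E => cutoff (‖y - x‖ ^ 2 / ε ^ 2) := fun ε =>
    contDiff_cutoff_sub.continuous
  have hqn : ∀ (ε : ℝ) (y : E), ‖cutoff (‖y - x‖ ^ 2 / ε ^ 2)‖ ≤ 1 := fun ε y => by
    rw [Real.norm_of_nonneg (cutoff_mem_Icc _).1]
    exact (cutoff_mem_Icc _).2
  have hqi : ∀ ε : ℝ, IntegrableOn (fun y => cutoff (‖y - x‖ ^ 2 / ε ^ 2) • g y) V := fun ε =>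
    Integrable.bdd_smul hgi 1 (hqm ε).aestronglyMeasurable (.of_forall (hqn ε))
  have hlim1 : Tendsto (fun ε : ℝ => ∫ y in V, cutoff (‖y - x‖ ^ 2 / ε ^ 2) • g y) (𝓝[>] 0)
      (𝓝 (∫ y in V, g y)) := by
    refine tendsto_integral_filter_of_dominated_convergence (fun y => ‖g y‖)
      (.of_forall fun ε => (hqi ε).aestronglyMeasurable)
      (.of_forall fun ε => .of_forall fun y => ?_)
      hgi.norm (.of_forall fun y => ?_)
    · rw [norm_smul]
      exact mul_le_of_le_one_left (norm_nonneg _) (hqn ε y)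
    · by_cases hy : y = x
      -- at `x` both sides vanish, as the kernel has the value `0` at the origin
      · simp [hg, hy, newtonKernel_zero]
      · refine tendsto_const_nhds.congr' ?_
        filter_upwards [eventually_cutoff_sub_eq_one hy] with ε hε
        rw [hε, one_smul]
  have hlim2 := tendsto_setIntegral_cutoffDensity_smul hc hc1 hVo (hfc.mono subset_closure) hx
  obtain ⟨r, hr, hrV⟩ := Metric.isOpen_iff.1 hVo x hx
  have hlim3 : Tendsto (fun ε : ℝ => (∫ y in V, cutoff (‖y - x‖ ^ 2 / ε ^ 2) • g y) +
      ∫ y in V, cutoffDensity m c ε ‖y - x‖ • f y) (𝓝[>] 0)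
      (𝓝 (∫ y in frontier V, kernelForm κ α c x f y (exteriorUnitNormal V y)
        ∂Measure.euclideanHausdorffMeasure m)) := by
    refine tendsto_const_nhds.congr' ?_
    filter_upwards [Ioo_mem_nhdsGT hr] with ε hε
    have hdi : IntegrableOn (fun y => cutoffDensity m c ε ‖y - x‖ • f y) V := by
      have h0 : Integrable fun y : E => cutoffDensity m c ε ‖y - x‖ :=
        (integrable_cutoffDensity hc hε.1).comp_sub_right x
      exact h0.integrableOn.smul_bdd C hfm
        ((ae_restrict_iff' hVo.measurableSet).2 (.of_forall fun y hy => hC y (subset_closure hy)))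
    -- the Gauss–Green formula for the truncated form, which is `C¹` in all of `V`
    have hdiv : EqOn
        (formDiv fun y => cutoff (‖y - x‖ ^ 2 / ε ^ 2) • kernelForm κ α c x f y)
        (fun y => cutoff (‖y - x‖ ^ 2 / ε ^ 2) • g y + cutoffDensity m c ε ‖y - x‖ • f y) V :=
      fun y hy => formDiv_cutoff_kernelForm hκα (hf.contDiffAt (hVo.mem_nhds hy))
    have hGG := hV.setIntegral_formDiv hVo hVb
      (contDiffOn_cutoff_smul_kernelForm (κ := κ) (α := α) (c := c) (x := x) (ε := ε) hVo hf)
      (continuousOn_cutoff_smul_kernelForm hfc)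
      (((hqi ε).add hdi).congr_fun hdiv.symm hVo.measurableSet)
    rw [setIntegral_congr_fun hVo.measurableSet hdiv, integral_add (hqi ε) hdi] at hGG
    rw [hGG]
    refine setIntegral_congr_fun isClosed_frontier.measurableSet fun y hy => ?_
    -- the cutoff is `1` on the boundary, which lies outside the ball of radius `r`
    have hry : r ≤ ‖y - x‖ := by
      rw [hVo.frontier_eq] at hy
      by_contra! hlt
      exact hy.2 (hrV (mem_ball_iff_norm.2 hlt))
    have := hε.1
    have hq : cutoff (‖y - x‖ ^ 2 / ε ^ 2) = 1 :=
      cutoff_of_ge ((one_le_div (by positivity)).2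
        (pow_le_pow_left₀ hε.1.le (hε.2.le.trans hry) 2))
    simp only [hq, one_smul]
  exact eq_sub_of_add_eq' (tendsto_nhds_unique (hlim1.add hlim2) hlim3)

end CauchyPompeiu

/-! ### Octonions and slices -/

namespace Octonion

/-- The octonionic product as a continuous bilinear map. -/
def mulCLM : Octonion →L[ℝ] Octonion →L[ℝ] Octonion :=
  (LinearMap.mk₂ ℝ mul
    (fun a b c => by ext k; simp [mul, add_mul, mul_add, Finset.sum_add_distrib])
    (fun t a b => by ext k; simp only [mul, PiLp.smul_apply, smul_eq_mul, Finset.mul_sum]; grind)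
    (fun a b c => by ext k; simp [mul, mul_add, Finset.sum_add_distrib])
    (fun t a b => by ext k; simp only [mul, PiLp.smul_apply, smul_eq_mul, Finset.mul_sum]; grind)
    ).toContinuousBilinearMap

theorem mulCLM_apply (a b : Octonion) : mulCLM a b = mul a b := rfl

/-- Conjugation as a continuous linear map. -/
def conjCLM : Octonion →L[ℝ] Octonion :=
  LinearMap.toContinuousLinearMap
    { toFun := conj
      map_add' := fun a b => by
        ext k
        by_cases hk : k = 0 <;> simp [conj, hk, add_comm]
      map_smul' := fun t a => by
        ext k
        by_cases hk : k = 0 <;> simp [conj, hk] }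

/-- The product of two octonions in coordinates. -/
theorem mul_eq (x y : Octonion) : mul x y = WithLp.toLp 2 ![
    x 0 * y 0 - x 1 * y 1 - x 2 * y 2 - x 3 * y 3 - x 4 * y 4 - x 5 * y 5 - x 6 * y 6 - x 7 * y 7,
    x 0 * y 1 + x 1 * y 0 + x 2 * y 3 - x 3 * y 2 + x 4 * y 5 - x 5 * y 4 - x 6 * y 7 + x 7 * y 6,
    x 0 * y 2 - x 1 * y 3 + x 2 * y 0 + x 3 * y 1 + x 4 * y 6 + x 5 * y 7 - x 6 * y 4 - x 7 * y 5,
    x 0 * y 3 + x 1 * y 2 - x 2 * y 1 + x 3 * y 0 + x 4 * y 7 - x 5 * y 6 + x 6 * y 5 - x 7 * y 4,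
    x 0 * y 4 - x 1 * y 5 - x 2 * y 6 - x 3 * y 7 + x 4 * y 0 + x 5 * y 1 + x 6 * y 2 + x 7 * y 3,
    x 0 * y 5 + x 1 * y 4 - x 2 * y 7 + x 3 * y 6 - x 4 * y 1 + x 5 * y 0 - x 6 * y 3 + x 7 * y 2,
    x 0 * y 6 + x 1 * y 7 + x 2 * y 4 - x 3 * y 5 - x 4 * y 2 + x 5 * y 3 + x 6 * y 0 - x 7 * y 1,
    x 0 * y 7 - x 1 * y 6 + x 2 * y 5 + x 3 * y 4 - x 4 * y 3 - x 5 * y 2 + x 6 * y 1 + x 7 * y 0]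
    := by
  ext k
  fin_cases k <;> simp [mul, Fin.sum_univ_eight, structureConst, eps, triples] <;> ring

/-- Left alternativity and `ā a = |a|²`: left multiplication by `ā` inverts, up to the factor
`|a|²`, left multiplication by `a`. This replaces associativity. -/
theorem mul_conj_mul (a g : Octonion) : mul (conj a) (mul a g) = ‖a‖ ^ 2 • g := by
  rw [EuclideanSpace.norm_sq_eq]
  ext k
  fin_cases k <;> simp [mul_eq, conj, Fin.sum_univ_eight] <;> ring

variable {p : ℕ} {η : Octonion}

theorem e_eq_basisFun {i : ℕ} (hi : i < 8) : e i = EuclideanSpace.basisFun (Fin 8) ℝ ⟨i, hi⟩ := by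
  ext k
  simp [e, Fin.ext_iff]

theorem orthonormal_e (hp : p ≤ 6) : Orthonormal ℝ fun i : Fin (p + 1) => e i := by
  have h := (EuclideanSpace.basisFun (Fin 8) ℝ).orthonormal.comp
    (Fin.castLE (by lia : p + 1 ≤ 8)) (Fin.castLE_injective _)
  have he : (fun i : Fin (p + 1) => e i) =
      EuclideanSpace.basisFun (Fin 8) ℝ ∘ Fin.castLE (by lia : p + 1 ≤ 8) :=
    funext fun i => e_eq_basisFun (by lia)
  rw [he]
  exact h

theorem norm_sliceEmb (hp : p ≤ 6) (hη : η ∈ unitSphere p) (v : EuclideanSpace ℝ (Fin (p + 2))) :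
    ‖sliceEmb p η v‖ = ‖v‖ := by
  have h1 : inner ℝ (∑ i : Fin (p + 1), v i.castSucc • e i) (v (Fin.last (p + 1)) • η) = 0 := by
    rw [sum_inner]
    refine Finset.sum_eq_zero fun i _ => ?_
    have hi : (i : ℕ) < 8 := by lia
    rw [inner_smul_left, inner_smul_right, e_eq_basisFun hi, EuclideanSpace.basisFun_inner,
      hη.1 ⟨i, hi⟩ (by simp; lia)]
    simp
  have h2 : ‖∑ i : Fin (p + 1), v i.castSucc • e i‖ ^ 2 = ∑ i : Fin (p + 1), v i.castSucc ^ 2 := by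
    rw [← real_inner_self_eq_norm_sq, (orthonormal_e hp).inner_sum]
    simp [sq]
  rw [← sq_eq_sq₀ (norm_nonneg _) (norm_nonneg _), sliceEmb, norm_add_sq_real, h1, h2,
    norm_smul, hη.2, EuclideanSpace.norm_sq_eq, Fin.sum_univ_castSucc (n := p + 1)]
  simp

/-- The embedding of the slice as a continuous linear map. -/
def sliceEmbCLM (p : ℕ) (η : Octonion) : EuclideanSpace ℝ (Fin (p + 2)) →L[ℝ] Octonion :=
  LinearMap.toContinuousLinearMap
    { toFun := sliceEmb p η
      map_add' := fun a b => by
        simp only [sliceEmb, PiLp.add_apply, add_smul, Finset.sum_add_distrib]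
        abel
      map_smul' := fun t a => by
        simp [sliceEmb, smul_smul, Finset.smul_sum] }

theorem sliceEmbCLM_apply (v : EuclideanSpace ℝ (Fin (p + 2))) :
    sliceEmbCLM p η v = sliceEmb p η v := rfl

theorem sliceEmb_single_castSucc (i : Fin (p + 1)) :
    sliceEmb p η (EuclideanSpace.single i.castSucc 1) = e i := by
  simp [sliceEmb, Fin.castSucc_inj]

theorem sliceEmb_single_last :
    sliceEmb p η (EuclideanSpace.single (Fin.last (p + 1)) 1) = η := by
  simp [sliceEmb, Fin.castSucc_ne_last]

theorem isOpen_slice {U : Set Octonion} (hU : IsOpen U) : IsOpen (slice p η U) :=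
  hU.preimage (sliceEmbCLM p η).continuous

theorem isBounded_slice (hp : p ≤ 6) (hη : η ∈ unitSphere p) {U : Set Octonion}
    (hU : Bornology.IsBounded U) : Bornology.IsBounded (slice p η U) := by
  obtain ⟨C, hC⟩ := hU.exists_norm_le
  exact isBounded_iff_forall_norm_le.2 ⟨C, fun v hv => norm_sliceEmb hp hη v ▸ hC _ hv⟩

/-- Left multiplication by the points of the slice. -/
def sliceMul (p : ℕ) (η : Octonion) :
    EuclideanSpace ℝ (Fin (p + 2)) →L[ℝ] Octonion →L[ℝ] Octonion :=
  mulCLM ∘L sliceEmbCLM p η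

/-- Left multiplication by the conjugates of the points of the slice. -/
def sliceConjMul (p : ℕ) (η : Octonion) :
    EuclideanSpace ℝ (Fin (p + 2)) →L[ℝ] Octonion →L[ℝ] Octonion :=
  mulCLM ∘L conjCLM ∘L sliceEmbCLM p η

theorem sliceConjMul_sliceMul (hp : p ≤ 6) (hη : η ∈ unitSphere p)
    (v : EuclideanSpace ℝ (Fin (p + 2))) (g : Octonion) :
    sliceConjMul p η v (sliceMul p η v g) = ‖v‖ ^ 2 • g :=
  (mul_conj_mul _ g).trans (by rw [← norm_sliceEmb hp hη v]; rfl)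

theorem sliceD_eq_symbolOp (f : EuclideanSpace ℝ (Fin (p + 2)) → Octonion) :
    sliceD p η f = symbolOp (m := p + 1) (sliceMul p η) f := by
  ext1 y
  rw [sliceD, symbolOp, Fin.sum_univ_castSucc (n := p + 1)]
  simp only [sliceMul, ContinuousLinearMap.comp_apply, sliceEmbCLM_apply, mulCLM_apply,
    sliceEmb_single_castSucc, sliceEmb_single_last, partialDeriv]

/-- On the slice, the Cauchy kernel is the conjugate of the Newton kernel of `ℝ^{p+2}`. -/
theorem mul_cauchyKernel (hp : p ≤ 6) (hη : η ∈ unitSphere p)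
    (x y : EuclideanSpace ℝ (Fin (p + 2))) (g : Octonion) :
    mul (cauchyKernel p (sliceEmb p η y - sliceEmb p η x)) g =
      sliceConjMul p η (newtonKernel (m := p + 1) (1 / sphereArea p) (y - x)) g := by
  have h : sliceEmb p η y - sliceEmb p η x = sliceEmb p η (y - x) :=
    (map_sub (sliceEmbCLM p η) y x).symm
  rw [h, cauchyKernel, norm_sliceEmb hp hη, newtonKernel, map_smul, ← mulCLM_apply, map_smul,
    div_div]
  rfl

theorem sphereArea_pos (p : ℕ) : 0 < sphereArea p := by
  have h1 := Real.Gamma_pos_of_pos (s := 1 / 2) (by norm_num)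
  have h2 := Real.Gamma_pos_of_pos (s := ((p : ℝ) + 2) / 2) (by positivity)
  unfold sphereArea
  positivity

/-- The area of the unit sphere is the dimension times the volume of the unit ball. -/
theorem sphereArea_eq (p : ℕ) :
    sphereArea p = (p + 2) * volume.real (ball (0 : EuclideanSpace ℝ (Fin (p + 2))) 1) := by
  have h2 := Real.Gamma_pos_of_pos (s := ((p : ℝ) + 2) / 2) (by positivity)
  have h3 : Real.Gamma (((p : ℝ) + 2) / 2 + 1) =
      ((p : ℝ) + 2) / 2 * Real.Gamma (((p : ℝ) + 2) / 2) :=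
    Real.Gamma_add_one (by positivity)
  rw [Measure.real, EuclideanSpace.volume_ball, Fintype.card_fin, sphereArea,
    Real.Gamma_one_half_eq]
  push_cast
  rw [h3, ENNReal.ofReal_one, one_pow, one_mul, ENNReal.toReal_ofReal (by positivity)]
  field_simp

end Octonion

end

/-! ### The formulas on an octonionic slice -/

theorem mainTheorem3 (p : ℕ) (hp : p ≤ 6) (η : Octonion) (hη : η ∈ Octonion.unitSphere p)
    (U : Set Octonion) (hUo : IsOpen U) (hUc : IsConnected U) (hUb : Bornology.IsBounded U)
    (hUs : HasSmoothBoundary (Octonion.slice p η U))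
    (f : EuclideanSpace ℝ (Fin (p + 2)) → Octonion)
    (hf : ContDiffOn ℝ 1 f (Octonion.slice p η U))
    (hfc : ContinuousOn f (closure (Octonion.slice p η U)))
    (x : EuclideanSpace ℝ (Fin (p + 2))) (hx : x ∈ Octonion.slice p η U) :
    -- the boundary integral converges
    IntegrableOn
      (fun y => Octonion.mul
        (Octonion.cauchyKernel p (Octonion.sliceEmb p η y - Octonion.sliceEmb p η x))
        (Octonion.mul
          (Octonion.sliceEmb p η (exteriorUnitNormal (Octonion.slice p η U) y)) (f y)))
      (frontier (Octonion.slice p η U)) (Measure.euclideanHausdorffMeasure (p + 1)) ∧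
    -- the Cauchy-Pompeiu formula
    (IntegrableOn (Octonion.sliceD p η f) (Octonion.slice p η U) volume →
      IntegrableOn
        (fun y => Octonion.mul
          (Octonion.cauchyKernel p (Octonion.sliceEmb p η y - Octonion.sliceEmb p η x))
          (Octonion.sliceD p η f y))
        (Octonion.slice p η U) volume ∧
      f x =
        (∫ y in frontier (Octonion.slice p η U),
          Octonion.mul
            (Octonion.cauchyKernel p (Octonion.sliceEmb p η y - Octonion.sliceEmb p η x))
            (Octonion.mul
              (Octonion.sliceEmb p η (exteriorUnitNormal (Octonion.slice p η U) y)) (f y))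
          ∂(Measure.euclideanHausdorffMeasure (p + 1))) -
        ∫ y in Octonion.slice p η U,
          Octonion.mul
            (Octonion.cauchyKernel p (Octonion.sliceEmb p η y - Octonion.sliceEmb p η x))
            (Octonion.sliceD p η f y)) ∧
    -- the Cauchy formula
    ((∀ y ∈ Octonion.slice p η U, Octonion.sliceD p η f y = 0) →
      f x =
        ∫ y in frontier (Octonion.slice p η U),
          Octonion.mul
            (Octonion.cauchyKernel p (Octonion.sliceEmb p η y - Octonion.sliceEmb p η x))
            (Octonion.mul
              (Octonion.sliceEmb p η (exteriorUnitNormal (Octonion.slice p η U) y)) (f y))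
          ∂(Measure.euclideanHausdorffMeasure (p + 1))) := by
  have hVo : IsOpen (Octonion.slice p η U) := Octonion.isOpen_slice hUo
  have hVb : Bornology.IsBounded (Octonion.slice p η U) := Octonion.isBounded_slice hp hη hUb
  have hc : 0 ≤ 1 / Octonion.sphereArea p := one_div_nonneg.2 (Octonion.sphereArea_pos p).le
  -- the normalization of the kernel: the unit sphere has area `σ_{p+1}`
  have hc1 : (((p + 1 : ℕ) : ℝ) + 1) *
      volume.real (Metric.ball (0 : EuclideanSpace ℝ (Fin (p + 1 + 1))) 1) *
        (1 / Octonion.sphereArea p) = 1 := by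
    have h := Octonion.sphereArea_eq p
    have h0 := (Octonion.sphereArea_pos p).ne'
    rw [mul_one_div, div_eq_one_iff_eq h0, h]
    push_cast
    ring
  have hform : ∀ y, Octonion.mul
      (Octonion.cauchyKernel p (Octonion.sliceEmb p η y - Octonion.sliceEmb p η x))
      (Octonion.mul
        (Octonion.sliceEmb p η (exteriorUnitNormal (Octonion.slice p η U) y)) (f y)) =
      kernelForm (m := p + 1) (Octonion.sliceConjMul p η) (Octonion.sliceMul p η)
        (1 / Octonion.sphereArea p) x f y (exteriorUnitNormal (Octonion.slice p η U) y) :=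
    fun y => Octonion.mul_cauchyKernel hp hη x y _
  have hCP : IntegrableOn (Octonion.sliceD p η f) (Octonion.slice p η U) volume →
      f x = (∫ y in frontier (Octonion.slice p η U),
          kernelForm (m := p + 1) (Octonion.sliceConjMul p η) (Octonion.sliceMul p η)
            (1 / Octonion.sphereArea p) x f y (exteriorUnitNormal (Octonion.slice p η U) y)
          ∂(Measure.euclideanHausdorffMeasure (p + 1))) -
        ∫ y in Octonion.slice p η U, Octonion.sliceConjMul p η
          (newtonKernel (m := p + 1) (1 / Octonion.sphereArea p) (y - x))
          (Octonion.sliceD p η f y) := fun hD => by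
    rw [Octonion.sliceD_eq_symbolOp] at hD ⊢
    exact hUs.cauchyPompeiu (m := p + 1) (Octonion.sliceConjMul_sliceMul hp hη) hc hc1 hVo hVb
      hf hfc hx hD
  simp only [hform, Octonion.mul_cauchyKernel hp hη]
  refine ⟨hUs.integrableOn_kernelForm (m := p + 1) hVo hVb hfc hx, fun hD => ⟨?_, hCP hD⟩,
    fun hD0 => ?_⟩
  · refine integrableOn_newtonKernel_apply (m := p + 1) hc hVo ?_ hD hx
    rw [Octonion.sliceD_eq_symbolOp]
    exact continuousOn_symbolOp (m := p + 1) hVo hf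
  · have hD : IntegrableOn (Octonion.sliceD p η f) (Octonion.slice p η U) volume :=
      integrableOn_zero.congr_fun (fun y hy => (hD0 y hy).symm) hVo.measurableSet
    have h0 : ∫ y in Octonion.slice p η U, Octonion.sliceConjMul p η
        (newtonKernel (m := p + 1) (1 / Octonion.sphereArea p) (y - x))
        (Octonion.sliceD p η f y) = 0 :=
      setIntegral_eq_zero_of_forall_eq_zero fun y hy => by rw [hD0 y hy, map_zero]
    rw [hCP hD, h0, sub_zero]
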